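/- Let $0\le b\le d$ be integers, and let $\mathbb{C}[s,t]_d$ be the space of binary forms of degree $d$. Identify a point $(\alpha:\beta:\gamma:\delta)\in\mathbb{P}^3$ with the class of the matrix $\left(\begin{smallmatrix}\alpha&\beta\\ \gamma&\delta\end{smallmatrix}\right)$, let $R=\mathbb{C}[\alpha,\beta,\gamma,\delta]$, and let $U\subseteq\mathbb{P}^3$ be the complement of the quadric $\alpha\delta-\beta\gamma=0$. Given a subspace $V_b\subseteq\mathbb{C}[s,t]_d$ of dimension $b+1$ with basis $G_0,\dots,G_b$, let $\mathcal{M}$ be the $(b+1)\times(d+1)$ matrix over $R$ whose $(i,j)$ entry is the coefficient of $s^{d-j}t^{j}$ in $G_i(\alpha s+\beta t,\gamma s+\delta t)$, let $M\subseteq R(d)^{b+1}$ be the graded $R$-submodule generated by the columns of $\mathcal{M}$, and let $\mathscr{M}=\widetilde{M}$ be the associated coherent sheaf on $\mathbb{P}^3$. Put $$\widehat{B}=\{(x:y)\in\mathbb{P}^1 : \text{some nonzero } G\in V_b \text{ vanishes to order at least } b+1 \text{ at } (x:y)\}.$$ For a general $V_b$ (that is, for all $V_b$ in some nonempty Zariski-open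 subset of the Grassmannian of $(b+1)$-dimensional subspaces of $\mathbb{C}[s,t]_d$) the following holds. The set $\widehat{B}$ consists of exactly $(b+1)(d-b)$ points; for $(x:y)\in\widehat{B}$ the sets $\{(xu:xv:yu:yv) : (u:v)\in\mathbb{P}^1\}$ are pairwise disjoint lines in $\mathbb{P}^3$; and, if $U'$ denotes the complement of the union of these $(b+1)(d-b)$ lines, then $U'$ is open, $U'\supseteq U$, and $\mathscr{M}$ is locally free on $U'$ (for every choice of the basis $G_0,\dots,G_b$). -/

import Mathlib

open AlgebraicGeometry CategoryTheory TopologicalSpace Opposite MvPolynomial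
open scoped LinearAlgebra.Projectivization

noncomputable section

/-! ### The sheaf of modules on `Proj 𝒜` associated to a graded module -/

namespace ProjTilde

variable {σ A N : Type} [CommRing A] [SetLike σ A] [AddSubgroupClass σ A]
  (𝒜 : ℕ → σ) [GradedRing 𝒜] [AddCommGroup N] [Module A N]
  (𝒩 : ℕ → AddSubgroup N)

/-- The localization of `N` at the homogeneous prime `x`. Sections of the sheaf associated to `N`
take their values in its degree-zero part, by the condition `IsFraction` below. -/
abbrev Loc (N : Type) [AddCommGroup N] [Module A N] (x : ProjectiveSpectrum 𝒜) : Type :=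
  LocalizedModule x.asHomogeneousIdeal.toIdeal.primeCompl N

variable {𝒜} in
/-- The family `s` on `U` is a single fraction `n / f` with `n`, `f` homogeneous of the same degree
and `f` nowhere zero on `U`. -/
def IsFraction {U : Opens (ProjectiveSpectrum.top 𝒜)} (s : ∀ x : U, Loc 𝒜 N x.1) : Prop :=
  ∃ (e : ℕ) (n : N) (f : A), n ∈ 𝒩 e ∧ f ∈ 𝒜 e ∧
    ∀ x : U, ∃ hf : f ∉ x.1.asHomogeneousIdeal.toIdeal, s x = LocalizedModule.mk n ⟨f, hf⟩

def isFractionPrelocal : TopCat.PrelocalPredicate fun x : ProjectiveSpectrum.top 𝒜 => Loc 𝒜 N x where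
  pred s := IsFraction 𝒩 s
  res := by
    rintro V U i s ⟨e, n, f, hn, hf, h⟩
    exact ⟨e, n, f, hn, hf, fun x => h (i x)⟩

/-- Being locally a fraction of degree zero. -/
def isLocallyFraction : TopCat.LocalPredicate fun x : ProjectiveSpectrum.top 𝒜 => Loc 𝒜 N x :=
  (isFractionPrelocal 𝒜 𝒩).sheafify

variable [SetLike.GradedSMul 𝒜 𝒩]

/-- The sections over `U` of the sheaf associated to `N`. -/
def sections (U : (Opens (ProjectiveSpectrum.top 𝒜))ᵒᵖ) :
    AddSubgroup (∀ x : U.unop, Loc 𝒜 N x.1) where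
  carrier := {s | (isLocallyFraction 𝒜 𝒩).pred s}
  zero_mem' := fun x => ⟨unop U, x.2, 𝟙 _, 0, 0, 1, zero_mem _, SetLike.one_mem_graded _,
    fun y => ⟨fun h => y.1.isPrime.ne_top ((Ideal.eq_top_iff_one _).2 h), by
      simp⟩⟩
  add_mem' := by
    intro s t hs ht x
    obtain ⟨V, hV, i, e, n, f, hn, hf, h⟩ := hs x
    obtain ⟨W, hW, j, e', n', f', hn', hf', h'⟩ := ht x
    refine ⟨V ⊓ W, ⟨hV, hW⟩, Opens.infLELeft _ _ ≫ i, e + e', f' • n + f • n', f * f',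
      add_mem ?_ ?_, SetLike.mul_mem_graded hf hf', fun y => ?_⟩
    · have := SetLike.GradedSMul.smul_mem (A := 𝒜) (B := 𝒩) hf' hn
      rwa [vadd_eq_add, add_comm] at this
    · exact SetLike.GradedSMul.smul_mem (A := 𝒜) (B := 𝒩) hf hn'
    · obtain ⟨g, hg⟩ := h ⟨y.1, y.2.1⟩
      obtain ⟨g', hg'⟩ := h' ⟨y.1, y.2.2⟩
      refine ⟨fun hy => (y.1.isPrime.mem_or_mem hy).elim g g', ?_⟩
      refine (congrArg₂ (· + ·) hg hg').trans ?_
      exact LocalizedModule.mk_add_mk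
  neg_mem' := by
    intro s hs x
    obtain ⟨V, hV, i, e, n, f, hn, hf, h⟩ := hs x
    refine ⟨V, hV, i, e, -n, f, neg_mem hn, hf, fun y => ?_⟩
    obtain ⟨g, hg⟩ := h y
    exact ⟨g, (congrArg Neg.neg hg).trans LocalizedModule.mk_neg.symm⟩

/-- The sections over `U` of the structure sheaf act pointwise. -/
theorem smul_mem (U : (Opens (ProjectiveSpectrum.top 𝒜))ᵒᵖ)
    (a : (ProjectiveSpectrum.Proj.structureSheaf 𝒜).1.obj U) {s : ∀ x : U.unop, Loc 𝒜 N x.1}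
    (hs : s ∈ sections 𝒜 𝒩 U) :
    (fun x => (a.1 x).val • s x : ∀ x : U.unop, Loc 𝒜 N x.1) ∈ sections 𝒜 𝒩 U := by
  intro x
  obtain ⟨V, hV, i, e, n, f, hn, hf, h⟩ := hs x
  obtain ⟨W, hW, j, e', ⟨r, hr⟩, ⟨q, hq⟩, hq', h'⟩ := a.2 x
  refine ⟨V ⊓ W, ⟨hV, hW⟩, Opens.infLELeft _ _ ≫ i, e' + e, r • n, q * f,
      SetLike.GradedSMul.smul_mem (A := 𝒜) (B := 𝒩) hr hn, SetLike.mul_mem_graded hq hf, fun y => ?_⟩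
  obtain ⟨g, hg⟩ := h ⟨y.1, y.2.1⟩
  have hg' := h' ⟨y.1, y.2.2⟩
  refine ⟨fun hy => (y.1.isPrime.mem_or_mem hy).elim (hq' ⟨y.1, y.2.2⟩) g, ?_⟩
  refine (congrArg₂ (fun u v => HomogeneousLocalization.val u • v) hg' hg).trans ?_
  rw [HomogeneousLocalization.val_mk]
  exact LocalizedModule.mk_smul_mk _ _ _ _

instance sectionsModule (U : (Opens (ProjectiveSpectrum.top 𝒜))ᵒᵖ) :
    Module ((Proj 𝒜).ringCatSheaf.obj.obj U) (sections 𝒜 𝒩 U) where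
  smul a s := ⟨_, smul_mem 𝒜 𝒩 U a s.2⟩
  one_smul s := Subtype.ext <| funext fun x =>
    (congrArg (· • s.1 x) (HomogeneousLocalization.val_one)).trans (one_smul _ _)
  mul_smul _ _ s := Subtype.ext <| funext fun x =>
    (congrArg (· • s.1 x) (HomogeneousLocalization.val_mul _ _)).trans (mul_smul _ _ _)
  smul_zero _ := Subtype.ext <| funext fun _ => smul_zero _
  smul_add _ _ _ := Subtype.ext <| funext fun _ => smul_add _ _ _
  add_smul _ _ s := Subtype.ext <| funext fun x =>
    (congrArg (· • s.1 x) (HomogeneousLocalization.val_add _ _)).trans (add_smul _ _ _)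
  zero_smul s := Subtype.ext <| funext fun x =>
    (congrArg (· • s.1 x) (HomogeneousLocalization.val_zero)).trans (zero_smul _ _)

/-- The underlying presheaf of abelian groups, with the evident restriction maps. -/
def abPresheaf : (Proj 𝒜).Opensᵒᵖ ⥤ Ab where
  obj U := AddCommGrpCat.of (sections 𝒜 𝒩 U)
  map i := AddCommGrpCat.ofHom
    { toFun := (TopCat.subsheafToTypes (isLocallyFraction 𝒜 𝒩)).1.map i
      map_zero' := rfl
      map_add' := fun _ _ => rfl }

instance abPresheafModule (U : (Proj 𝒜).Opensᵒᵖ) :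
    Module ((Proj 𝒜).ringCatSheaf.obj.obj U) ((abPresheaf 𝒜 𝒩).obj U) :=
  sectionsModule 𝒜 𝒩 U

end ProjTilde

open ProjTilde in
/-- The sheaf of `𝒪`-modules on `Proj 𝒜` associated to the graded module `N` with homogeneous
pieces `𝒩 e`. -/
def projTilde {σ A N : Type} [CommRing A] [SetLike σ A] [AddSubgroupClass σ A]
    (𝒜 : ℕ → σ) [GradedRing 𝒜] [AddCommGroup N] [Module A N]
    (𝒩 : ℕ → AddSubgroup N) [SetLike.GradedSMul 𝒜 𝒩] : (Proj 𝒜).Modules where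
  val := PresheafOfModules.ofPresheaf (abPresheaf 𝒜 𝒩) (fun _ _ _ _ _ => by rfl)
  isSheaf := (TopCat.Presheaf.isSheaf_iff_isSheaf_comp (forget AddCommGrpCat) _).2
    (TopCat.subsheafToTypes (isLocallyFraction 𝒜 𝒩)).2

/-! ### Binary forms and the Grassmannian -/

namespace BinaryForm

/-- The space `ℂ[s,t]_d` of binary forms of degree `d`, with `s = X 0` and `t = X 1`. -/
abbrev Forms (d : ℕ) : Type := homogeneousSubmodule (Fin 2) ℂ d

/-- The exponent of the monomial `s ^ (d - j) * t ^ j`. -/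
def mono (d j : ℕ) : Fin 2 →₀ ℕ := Finsupp.single 0 (d - j) + Finsupp.single 1 j

/-- The Grassmannian of `(b + 1)`-dimensional subspaces of `ℂ[s,t]_d`. -/
abbrev Gr (b d : ℕ) : Type :=
  {V : Submodule ℂ (Forms d) // Module.finrank ℂ V = b + 1}

/-- Zariski-open subsets of the Grassmannian, as the quotient of the space of bases: membership of
`V` is the non-vanishing of one of a family of polynomials in the coefficients of a basis of `V`. -/
def IsZariskiOpen {b d : ℕ} (Ω : Set (Gr b d)) : Prop :=
  ∃ S : Set (MvPolynomial (Fin (b + 1) × Fin (d + 1)) ℂ),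
    ∀ (V : Gr b d) (G : Module.Basis (Fin (b + 1)) ℂ V.1),
      V ∈ Ω ↔ ∃ P ∈ S, eval (fun ij => coeff (mono d ij.2) (G ij.1).1.1) P ≠ 0

/-- The points `(x : y)` of the projective line at which some nonzero `G ∈ V` vanishes to order at
least `b + 1`, that is, is divisible by `(y s - x t) ^ (b + 1)`. -/
def badPoints {b d : ℕ} (V : Gr b d) : Set (ℙ ℂ (Fin 2 → ℂ)) :=
  {p | ∃ G ∈ V.1, G ≠ 0 ∧ (C (p.rep 1) * X 0 - C (p.rep 0) * X 1) ^ (b + 1) ∣ G.1}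

/-! ### Projective space of `2 × 2` matrices -/

/-- The homogeneous coordinate ring `ℂ[α, β, γ, δ]`, where
`α = X (0, 0)`, `β = X (0, 1)`, `γ = X (1, 0)`, `δ = X (1, 1)`. -/
abbrev R : Type := MvPolynomial (Fin 2 × Fin 2) ℂ

/-- The standard grading of the coordinate ring. -/
abbrev grading : ℕ → Submodule ℂ R := homogeneousSubmodule (Fin 2 × Fin 2) ℂ

instance : GradedRing grading := gradedAlgebra

/-- Projective three-space, as a scheme. -/
abbrev P3 : Scheme := Proj grading

/-- The complement of the quadric `α δ - β γ = 0`. -/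
def U : P3.Opens :=
  Proj.basicOpen grading (X (0, 0) * X (1, 1) - X (0, 1) * X (1, 0))

/-- Restriction of a polynomial to the line through the origin and `A`. -/
def toLine (A : Matrix (Fin 2) (Fin 2) ℂ) : R →ₐ[ℂ] Polynomial ℂ :=
  aeval fun ij => Polynomial.C (A ij.1 ij.2) * Polynomial.X

theorem coeff_toLine (A : Matrix (Fin 2) (Fin 2) ℂ) (f : R) (n : ℕ) :
    (toLine A f).coeff n = eval (fun ij => A ij.1 ij.2) (homogeneousComponent n f) := by
  induction f using MvPolynomial.induction_on' with
  | add p q hp hq => simp [hp, hq]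
  | monomial m c =>
    have h : toLine A (monomial m c) =
        Polynomial.C (c * m.prod fun ij k => A ij.1 ij.2 ^ k) * Polynomial.X ^ m.degree := by
      simp only [toLine, aeval_monomial, mul_pow, Finsupp.prod, Finset.prod_mul_distrib,
        Finset.prod_pow_eq_pow_sum, map_mul, map_prod, map_pow, mul_assoc]
      rfl
    rw [h, Polynomial.coeff_C_mul_X_pow]
    by_cases hn : n = m.degree
    · rw [if_pos hn, homogeneousComponent_of_mem (isHomogeneous_monomial c rfl), if_pos hn,
        eval_monomial]
    · rw [if_neg hn, homogeneousComponent_of_mem (isHomogeneous_monomial c rfl), if_neg hn, map_zero]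

/-- The closed point of `P3` with homogeneous coordinates `A`: a polynomial belongs to its ideal if
and only if all its homogeneous components vanish at `A`. -/
def closedPoint (A : ℙ ℂ (Matrix (Fin 2) (Fin 2) ℂ)) : P3 :=
  show ProjectiveSpectrum grading from
  { asHomogeneousIdeal := ⟨RingHom.ker (toLine A.rep), by
      intro n f hf
      have key : toLine A.rep (homogeneousComponent n f) = 0 := by
        ext k
        rw [coeff_toLine, homogeneousComponent_of_mem (homogeneousComponent_isHomogeneous n f)]
        split_ifs with h
        · rw [← coeff_toLine, (RingHom.mem_ker.1 hf : toLine A.rep f = 0)]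
          simp
        · simp
      have h : (DirectSum.decompose grading f n : R) = homogeneousComponent n f :=
        decomposition.decompose'_apply f n
      exact (congrArg (toLine A.rep) h).trans key⟩
    isPrime := RingHom.ker_isPrime _
    not_irrelevant_le := by
      intro h
      apply A.rep_nonzero
      ext i j
      have hX : (X (i, j) : R) ∈ HomogeneousIdeal.irrelevant grading := by
        rw [HomogeneousIdeal.mem_irrelevant_iff]
        exact DirectSum.decompose_of_mem_ne grading (isHomogeneous_X ℂ (i, j)) one_ne_zero
      have h0 : toLine A.rep (X (i, j)) = 0 := h hX
      simpa [toLine] using h0 }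

/-- The set of all `(x u, x v; y u, y v)`, where `p = (x : y)` and `(u : v)` varies. -/
def line (p : ℙ ℂ (Fin 2 → ℂ)) : Set (ℙ ℂ (Matrix (Fin 2) (Fin 2) ℂ)) :=
  {A | ∃ u : Fin 2 → ℂ, A.rep = Matrix.vecMulVec p.rep u}

/-- A line in the projective space of `E`. -/
def IsLine {E : Type} [AddCommGroup E] [Module ℂ E] (L : Set (ℙ ℂ E)) : Prop :=
  ∃ W : Submodule ℂ E, Module.finrank ℂ W = 2 ∧ L = {A | A.submodule ≤ W}

/-- The closed subset of the scheme `P3` whose closed points are those of `line p`. -/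
def closedLine (p : ℙ ℂ (Fin 2 → ℂ)) : Set P3 := closure (closedPoint '' line p)

/-! ### The sheaf -/

/-- The change of variables `s ↦ α s + β t`, `t ↦ γ s + δ t`. -/
def changeVariables : MvPolynomial (Fin 2) ℂ →ₐ[ℂ] MvPolynomial (Fin 2) R :=
  aeval fun i => C (X (i, 0)) * X 0 + C (X (i, 1)) * X 1

/-- The `i`-th row consists of the coefficients of `G i` after the change of variables. -/
def coeffMatrix {b d : ℕ} (G : Fin (b + 1) → Forms d) : Matrix (Fin (b + 1)) (Fin (d + 1)) R :=
  fun i j => coeff (mono d j) (changeVariables (G i).1)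

/-- The submodule of `R(d)^(b+1)` generated by the columns. -/
def columnModule {b d : ℕ} (G : Fin (b + 1) → Forms d) : Submodule R (Fin (b + 1) → R) :=
  Submodule.span R (Set.range fun j => fun i => coeffMatrix G i j)

/-- The degree-`e` piece of the column module: because of the shift in `R(d)^(b+1)`, it consists of
the elements with entries homogeneous of degree `e + d`. (The columns are of degree `0`, so there is
nothing in negative degrees.) -/
def columnGrading {b d : ℕ} (G : Fin (b + 1) → Forms d) (e : ℕ) : AddSubgroup (columnModule G) where
  carrier := {m | ∀ i, m.1 i ∈ grading (e + d)}
  zero_mem' := fun _ => zero_mem _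
  add_mem' := fun h h' i => add_mem (h i) (h' i)
  neg_mem' := fun h i => neg_mem (h i)

instance {b d : ℕ} (G : Fin (b + 1) → Forms d) :
    SetLike.GradedSMul grading (columnGrading G) where
  smul_mem := by
    intro i j f m hf hm k
    have := SetLike.mul_mem_graded hf (hm k)
    rwa [← add_assoc] at this

/-- The coherent sheaf on `P3` associated to the graded module generated by the columns. -/
def sheafM {b d : ℕ} (G : Fin (b + 1) → Forms d) : P3.Modules :=
  projTilde grading (columnGrading G)

end BinaryForm

end

/-! Let `g i` be `G i` with s = 1, and consider a point of P³ where α is invertible. Put z = γ/α and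
ε = δ − zβ, so that αε = αδ − βγ. Since γ + δt = z(α + βt) + εt, Taylor's formula at z expresses the
columns of the matrix through the vectors ε^k w_k, where w_k collects the k-th Hasse derivatives of
the `g i` at z. The transition matrix is triangular with powers of α on the diagonal
(`substCoeff_eq_sum`, `span_substVec`), so the module of columns is locally generated by the ε^k w_k
with k ≤ d.

Let W be the Wronskian det(w_0, …, w_b). If ε is a unit, the columns generate everything. If W(z) is
a unit, then w_0, …, w_b form a basis, the ε^k w_k with k ≥ b lie in the span of the first b + 1
generators, and these are independent because ε ≠ 0. On the quadric, W(z) is a non-unit only if z −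
ρ is one for a root ρ of W; then γ − ρα and δ − ρβ are both non-units, which says that the point is
on the line attached to (1 : ρ). Exchanging rows or columns reaches the other charts; at z = ∞
nothing goes wrong as long as `topMinor` is nonzero (`hasColumnBasis`). Clearing denominators and
taking homogeneous components spreads a basis over a local ring to a basic open set
(`isLocallyFree_sheafM`).

The same W governs the bad points: b + 1 linear conditions on a space of dimension b + 1 have a
nonzero solution exactly when their determinant vanishes. Up to a nonzero constant W is a
determinant of polars of degree at most d − b (`C_mul_wronskian`), so its degree is at most (b +
1)(d − b), with equality if and only if `topMinor` is nonzero. The general subspaces are those with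
`topMinor` nonzero and W without multiple root, an open condition given by a discriminant. Such
subspaces exist by induction on b: integrate a good family and adjoin 1 + cX^k for a suitable c
(`exists_wronskian_roots_nodup`). -/

noncomputable section

/-! ### Local freeness of a sheaf of modules from bases of sections -/

theorem exists_basis_of_existsUnique {A M I : Type*} [Ring A] [AddCommGroup M] [Module A M]
    [Fintype I] (v : I → M) (h : ∀ m : M, ∃! a : I → A, m = ∑ i, a i • v i) :
    ∃ b : Module.Basis I A M, ⇑b = v := by
  have hli : LinearIndependent A v := by
    rw [Fintype.linearIndependent_iff]
    intro g hg i
    have := (h 0).unique hg.symm (y₂ := 0) (by simp)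
    exact congrFun this i
  have hs : ⊤ ≤ Submodule.span A (Set.range v) := by
    intro m _
    obtain ⟨a, ha, -⟩ := h m
    rw [ha]
    exact Submodule.sum_mem _ fun i _ => Submodule.smul_mem _ _ (Submodule.subset_span ⟨i, rfl⟩)
  exact ⟨Module.Basis.mk hli hs, by simp⟩

universe u v₁ u₁

namespace SheafOfModules
open CategoryTheory.Limits

variable {C : Type u₁} [Category.{v₁} C] {J : GrothendieckTopology C} {R : Sheaf J RingCat.{u}}

/-- The morphism which sends the `i`-th member of a family of bases to the `i`-th section. -/
def homOfBasis {M N : SheafOfModules.{u} R} {I : Type u} [Fintype I] (s : I → M.sections)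
    (t : I → N.sections) (b : ∀ X, Module.Basis I (R.obj.obj X) (M.val.obj X))
    (hb : ∀ X i, b X i = PresheafOfModules.sections.eval (s i) X) : M ⟶ N where
  val :=
    { app := fun X => ModuleCat.ofHom ((b X).constr ℕ fun i => (PresheafOfModules.sections.eval (t i) X))
      naturality := by
        intro X Y f
        ext m
        have key : ((b Y).constr ℕ fun i => (PresheafOfModules.sections.eval (t i) Y)) (M.val.map f m) =
            N.val.map f ((b X).constr ℕ (fun i => (PresheafOfModules.sections.eval (t i) X)) m) := by
          have h1 : M.val.map f m = ∑ i, R.obj.map f ((b X).repr m i) • b Y i := by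
            conv_lhs => rw [← (b X).sum_repr m]
            refine (map_sum (M.val.restrictₛₗ f) _ _).trans (Finset.sum_congr rfl fun i _ => ?_)
            refine (M.val.map_smul f _ _).trans ?_
            rw [hb X i, hb Y i]
            exact congrArg _ ((s i).2 f)
          have h2 : N.val.map f (∑ i, (b X).repr m i • (PresheafOfModules.sections.eval (t i) X)) =
              ∑ i, R.obj.map f ((b X).repr m i) • (PresheafOfModules.sections.eval (t i) Y) := by
            refine (map_sum (N.val.restrictₛₗ f) _ _).trans (Finset.sum_congr rfl fun i _ => ?_)
            refine (N.val.map_smul f _ _).trans ?_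
            exact congrArg _ ((t i).2 f)
          rw [h1, map_sum, Module.Basis.constr_apply_fintype]
          simp only [map_smul, Module.Basis.constr_basis, Module.Basis.equivFun_apply]
          exact h2.symm
        exact key }

theorem homOfBasis_app {M N : SheafOfModules.{u} R} {I : Type u} [Fintype I] (s : I → M.sections)
    (t : I → N.sections) (b : ∀ X, Module.Basis I (R.obj.obj X) (M.val.obj X))
    (hb : ∀ X i, b X i = PresheafOfModules.sections.eval (s i) X) (X : Cᵒᵖ) (i : I) :
    (homOfBasis s t b hb).val.app X (PresheafOfModules.sections.eval (s i) X) = PresheafOfModules.sections.eval (t i) X := by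
  rw [← hb]
  exact (b X).constr_basis ℕ _ i

/-- Sections which form a basis over every object induce an isomorphism from a free sheaf. -/
theorem isIso_freeHomEquiv_symm [HasWeakSheafify J AddCommGrpCat.{u}]
    [J.WEqualsLocallyBijective AddCommGrpCat.{u}] (M : SheafOfModules.{u} R) {I : Type u}
    [Fintype I] (s : I → M.sections)
    (h : ∀ X (m : M.val.obj X), ∃! a : I → R.obj.obj X,
      m = ∑ i, a i • (PresheafOfModules.sections.eval (s i) X)) :
    IsIso (M.freeHomEquiv.symm s) := by
  choose b hb using fun X => exists_basis_of_existsUnique _ (h X)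
  have hb' : ∀ X i, b X i = PresheafOfModules.sections.eval (s i) X := fun X i => congrFun (hb X) i
  refine ⟨homOfBasis s freeSection b hb', ?_, ?_⟩
  · apply (freeHomEquiv _).injective
    funext i
    rw [freeHomEquiv_comp_apply, Equiv.apply_symm_apply]
    exact PresheafOfModules.sections_ext _ _ fun X => homOfBasis_app s freeSection b hb' X i
  · apply hom_ext
    ext X : 1
    apply ModuleCat.hom_ext
    refine (b X).ext fun i => ?_
    rw [hb']
    have h1 := homOfBasis_app s freeSection b hb' X i
    refine (congrArg ((M.freeHomEquiv.symm s).val.app X) h1).trans ?_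
    exact congrArg (fun t : M.sections => t.val X)
      (sectionsMap_freeHomEquiv_symm_freeSection s i)

end SheafOfModules

namespace AlgebraicGeometry.Scheme.Modules

variable {X : Scheme.{0}}

/-- The restrictions of a section over `W` to the opens contained in `W`, as a section of the
restricted sheaf. -/
def overSections (M : X.Modules) (U' W : X.Opens) (s : M.val.obj (op W)) :
    (SheafOfModules.over (R := U'.toScheme.ringCatSheaf) (M.restrict U'.ι) (U'.ι ⁻¹ᵁ W)).sections :=
  PresheafOfModules.sectionsMk
    (fun Y => show M.val.obj (op (U'.ι ''ᵁ Y.unop.left)) from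
      M.val.map (homOfLE (show U'.ι ''ᵁ Y.unop.left ≤ W from
        (Scheme.Hom.image_mono _ (leOfHom Y.unop.hom)).trans (U'.ι.image_preimage_le W))).op s)
    (by
      intro Y Z f
      have hYZ : U'.ι ''ᵁ Z.unop.left ≤ U'.ι ''ᵁ Y.unop.left :=
        Scheme.Hom.image_mono _ (leOfHom f.unop.left)
      exact (M.val.map_comp_apply (homOfLE (show U'.ι ''ᵁ Y.unop.left ≤ W from
        (Scheme.Hom.image_mono _ (leOfHom Y.unop.hom)).trans (U'.ι.image_preimage_le W))).op
          (homOfLE hYZ).op s).symm)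

/-- The identity map from sections of `M` to sections of its restriction. -/
def toOver (M : X.Modules) (U' W : X.Opens) (Y : (Over (U'.ι ⁻¹ᵁ W))ᵒᵖ) :
    M.val.obj (op (U'.ι ''ᵁ Y.unop.left)) →+
      (SheafOfModules.over (R := U'.toScheme.ringCatSheaf) (M.restrict U'.ι)
        (U'.ι ⁻¹ᵁ W)).val.obj Y where
  toFun m := m
  map_zero' := rfl
  map_add' _ _ := rfl

/-- Scalars act on the restricted sheaf through the inverse of `appIso`, which is an identity for
the inclusion of an open subset. -/
theorem toOver_smul (M : X.Modules) (U' W : X.Opens) (Y : (Over (U'.ι ⁻¹ᵁ W))ᵒᵖ)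
    (a : X.ringCatSheaf.obj.obj (op (U'.ι ''ᵁ Y.unop.left)))
    (m : M.val.obj (op (U'.ι ''ᵁ Y.unop.left))) :
    toOver M U' W Y (a • m) =
      (show (U'.toScheme.ringCatSheaf.over (U'.ι ⁻¹ᵁ W)).obj.obj Y from a) •
        toOver M U' W Y m := by
  have h : (U'.ι.appIso Y.unop.left).inv = 𝟙 _ := by
    rw [Scheme.Opens.ι_appIso]; rfl
  have h2 : (U'.ι.appIso Y.unop.left).inv a = a := by rw [h]; rfl
  conv_lhs => rw [← h2]
  rfl

theorem toOver_sum (M : X.Modules) (U' W : X.Opens) (Y : (Over (U'.ι ⁻¹ᵁ W))ᵒᵖ)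
    {I : Type} [Fintype I] (a : I → X.ringCatSheaf.obj.obj (op (U'.ι ''ᵁ Y.unop.left)))
    (t : I → M.val.obj (op (U'.ι ''ᵁ Y.unop.left))) :
    toOver M U' W Y (∑ i, a i • t i) =
      ∑ i, (show (U'.toScheme.ringCatSheaf.over (U'.ι ⁻¹ᵁ W)).obj.obj Y from a i) •
        toOver M U' W Y (t i) := by
  rw [map_sum]
  exact Finset.sum_congr rfl fun i _ => toOver_smul M U' W Y (a i) (t i)

theorem toOver_bijective (M : X.Modules) (U' W : X.Opens) (Y : (Over (U'.ι ⁻¹ᵁ W))ᵒᵖ) :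
    Function.Bijective (toOver M U' W Y) :=
  ⟨fun _ _ h => h, fun m => ⟨m, rfl⟩⟩

/-- The given sections over `W` restrict to a basis over every smaller open set, so they trivialize
the sheaf on the preimage of `W`; these preimages cover `U'`. -/
theorem isLocallyFree_restrict (M : X.Modules) (U' : X.Opens)
    (h : ∀ x ∈ U', ∃ W : X.Opens, x ∈ W ∧ ∃ (I : Type) (_ : Fintype I) (s : I → M.val.obj (op W)),
      ∀ (V : X.Opens) (hV : V ≤ W) (m : M.val.obj (op V)),
        ∃! a : I → X.ringCatSheaf.obj.obj (op V), m = ∑ i, a i • M.val.restrictₛₗ (homOfLE hV).op (s i)) :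
    SheafOfModules.IsLocallyFree (R := U'.toScheme.ringCatSheaf) (M.restrict U'.ι) := by
  choose! W hW I hI s hs using h
  have hiso : ∀ x : {x // x ∈ U'}, IsIso (SheafOfModules.freeHomEquiv _ |>.symm
      fun i => overSections M U' (W x) (s x i)) := by
    intro x
    let _ := hI x x.2
    apply SheafOfModules.isIso_freeHomEquiv_symm
    intro Y m
    have hY : U'.ι ''ᵁ Y.unop.left ≤ W x.1 := (Scheme.Hom.image_mono _ (leOfHom Y.unop.hom)).trans
      (U'.ι.image_preimage_le (W x.1))
    obtain ⟨m, rfl⟩ := (toOver_bijective M U' (W x.1) Y).2 m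
    obtain ⟨a, ha, hu⟩ := hs x.1 x.2 (U'.ι ''ᵁ Y.unop.left) hY m
    refine ⟨a, ?_, fun a' ha' => hu a' ?_⟩
    · exact (congrArg (toOver M U' (W x.1) Y) ha).trans (toOver_sum M U' (W x.1) Y a _)
    · exact (toOver_bijective M U' (W x.1) Y).1
        (ha'.trans (toOver_sum M U' (W x.1) Y a' fun i =>
          M.val.restrictₛₗ (homOfLE hY).op (s x.1 i)).symm)
  let q : SheafOfModules.LocalGeneratorsData (R := U'.toScheme.ringCatSheaf) (M.restrict U'.ι) :=
    { I := {x // x ∈ U'}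
      X := fun x => U'.ι ⁻¹ᵁ W x.1
      coversTop := by
        refine (_root_.Opens.coversTop_iff _ _).2 ?_
        refine eq_top_iff.2 fun x _ => ?_
        exact TopologicalSpace.Opens.mem_iSup.2 ⟨x, hW x.1 x.2⟩
      generators := fun x =>
        { I := I x.1
          s := fun i => overSections M U' (W x.1) (s x.1 i)
          epi := by
            have := hiso x
            infer_instance } }
  have : q.IsLocallyFreeData := ⟨fun x => hiso x⟩
  exact q.isLocallyFree

end AlgebraicGeometry.Scheme.Modules

/-! ### Local freeness of the sheaf associated to a graded module -/

namespace ProjTilde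

variable {σ A N : Type} [CommRing A] [SetLike σ A] [AddSubgroupClass σ A]
  (𝒜 : ℕ → σ) [GradedRing 𝒜] [AddCommGroup N] [Module A N]
  (𝒩 : ℕ → AddSubgroup N) [SetLike.GradedSMul 𝒜 𝒩]

/-- The stalk of the structure sheaf. -/
abbrev Stalk (x : ProjectiveSpectrum 𝒜) : Type :=
  HomogeneousLocalization.AtPrime 𝒜 x.asHomogeneousIdeal.toIdeal

/-- The section defined by an element of degree zero. -/
def ofDegreeZero (U : (Opens (ProjectiveSpectrum.top 𝒜))ᵒᵖ) (n : N) (hn : n ∈ 𝒩 0) :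
    sections 𝒜 𝒩 U :=
  ⟨fun _ => LocalizedModule.mk n 1, fun x => ⟨unop U, x.2, 𝟙 _, 0, n, 1, hn,
    SetLike.one_mem_graded _, fun y =>
      ⟨fun h => y.1.isPrime.ne_top ((Ideal.eq_top_iff_one _).2 h), rfl⟩⟩⟩

variable {𝒜} in
-- Dividing h n = ∑ q_i m_i by hf writes n/f with coefficients q_i/(hf), which have degree zero.
theorem mk_eq_sum {I : Type} [Fintype I] (m : I → N) (x : ProjectiveSpectrum 𝒜) {e a : ℕ} {n : N}
    {f h : A} (hf : f ∈ 𝒜 e) (hh : h ∈ 𝒜 a) (hfx : f ∉ x.asHomogeneousIdeal.toIdeal)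
    (hhx : h ∉ x.asHomogeneousIdeal.toIdeal) (q : I → A) (hq : ∀ i, q i ∈ 𝒜 (a + e))
    (hn : h • n = ∑ i, q i • m i) (hx : h * f ∉ x.asHomogeneousIdeal.toIdeal) :
    (LocalizedModule.mk n ⟨f, hfx⟩ : Loc 𝒜 N x) = ∑ i, (HomogeneousLocalization.mk
      (⟨a + e, ⟨q i, hq i⟩, ⟨h * f, SetLike.mul_mem_graded hh hf⟩, hx⟩ :
        HomogeneousLocalization.NumDenSameDeg 𝒜 x.asHomogeneousIdeal.toIdeal.primeCompl)).val •
          LocalizedModule.mk (m i) 1 := by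
  have h1 : ∀ i, (HomogeneousLocalization.mk
      (⟨a + e, ⟨q i, hq i⟩, ⟨h * f, SetLike.mul_mem_graded hh hf⟩, hx⟩ :
        HomogeneousLocalization.NumDenSameDeg 𝒜 x.asHomogeneousIdeal.toIdeal.primeCompl)).val •
          (LocalizedModule.mk (m i) 1 : Loc 𝒜 N x) = Localization.mk 1
            (⟨h * f, hx⟩ : x.asHomogeneousIdeal.toIdeal.primeCompl) •
            LocalizedModule.mkLinearMap _ N (q i • m i) := by
    intro i
    rw [HomogeneousLocalization.val_mk, LocalizedModule.mkLinearMap_apply]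
    exact (LocalizedModule.mk_smul_mk _ _ _ _).trans
      (((LocalizedModule.mk_smul_mk _ _ _ _).trans (by rw [one_smul])).symm)
  rw [Finset.sum_congr rfl fun i _ => h1 i, ← Finset.smul_sum, ← map_sum, ← hn,
    LocalizedModule.mkLinearMap_apply]
  refine ((LocalizedModule.mk_smul_mk _ _ _ _).trans ?_).symm
  rw [one_smul, mul_one]
  exact LocalizedModule.mk_cancel_common_left (S := x.asHomogeneousIdeal.toIdeal.primeCompl)
    ⟨h, hhx⟩ ⟨f, hfx⟩ n

variable {𝒜} in
-- Linear independence survives localization, and the degree-zero part embeds into the full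
-- localization.
theorem eq_of_sum_eq {I : Type} [Fintype I] {m : I → N} (hm : LinearIndependent A m)
    (x : ProjectiveSpectrum 𝒜)
    (a a' : I → Stalk 𝒜 x)
    (h : ∑ i, (a i).val • (LocalizedModule.mk (m i) 1 : Loc 𝒜 N x) =
      ∑ i, (a' i).val • (LocalizedModule.mk (m i) 1 : Loc 𝒜 N x)) : a = a' := by
  have hli := hm.of_isLocalizedModule (Localization x.asHomogeneousIdeal.toIdeal.primeCompl)
    x.asHomogeneousIdeal.toIdeal.primeCompl
    (LocalizedModule.mkLinearMap x.asHomogeneousIdeal.toIdeal.primeCompl N)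
  exact funext fun i => HomogeneousLocalization.val_injective _
    (Fintype.linearIndependent_iffₛ.1 hli _ _ h i)

theorem sum_apply {U : (Opens (ProjectiveSpectrum.top 𝒜))ᵒᵖ} {I : Type} [Fintype I]
    (a : I → (Proj 𝒜).ringCatSheaf.obj.obj U) (s : I → sections 𝒜 𝒩 U) (x : U.unop) :
    (∑ i, a i • s i).1 x = ∑ i, HomogeneousLocalization.val
      ((show (ProjectiveSpectrum.Proj.structureSheaf 𝒜).1.obj U from a i).1 x) • (s i).1 x := by
  have h : ∀ t : sections 𝒜 𝒩 U, t.1 x =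
    ((Pi.evalAddMonoidHom _ x).comp (sections 𝒜 𝒩 U).subtype) t := fun _ => rfl
  rw [h, map_sum]
  rfl

/-- Over an open set on which a homogeneous `h` does not vanish, elements `m i` of degree zero such
that `h` multiplies `N` into their span define a basis of the sections. -/
theorem existsUnique_eq_sum {I : Type} [Fintype I] {m : I → N} (hm : LinearIndependent A m)
    (hm0 : ∀ i, m i ∈ 𝒩 0) {a : ℕ} {h : A} (hh : h ∈ 𝒜 a)
    (hspan : ∀ e, ∀ n ∈ 𝒩 e, ∃ q : I → A, (∀ i, q i ∈ 𝒜 (a + e)) ∧ h • n = ∑ i, q i • m i)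
    (U : (Opens (ProjectiveSpectrum.top 𝒜))ᵒᵖ)
    (hU : ∀ x ∈ U.unop, h ∉ x.asHomogeneousIdeal.toIdeal) (s : sections 𝒜 𝒩 U) :
    ∃! c : I → (Proj 𝒜).ringCatSheaf.obj.obj U,
      s = ∑ i, c i • ofDegreeZero 𝒜 𝒩 U (m i) (hm0 i) := by
  have hloc : ∀ x : U.unop, ∃ c : I → Stalk 𝒜 x.1, s.1 x = ∑ i, (c i).val • LocalizedModule.mk (m i) 1 := by
    intro x
    obtain ⟨V, hV, i, e, n, f, hn, hf, hs⟩ := s.2 x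
    obtain ⟨q, hq, hqn⟩ := hspan e n hn
    obtain ⟨hfx, hx⟩ := hs ⟨x.1, hV⟩
    exact ⟨_, hx.trans (mk_eq_sum m x.1 hf hh hfx (hU _ x.2) q hq hqn
      fun hx => (x.1.isPrime.mem_or_mem hx).elim (hU _ x.2) hfx)⟩
  choose c hc using hloc
  -- The pointwise coefficients form a section: where `s` is n/f, the fractions q_k/(hf) satisfy the
  -- same equation, so by uniqueness they are these coefficients.
  have hcl : ∀ k, (ProjectiveSpectrum.StructureSheaf.isLocallyFraction 𝒜).pred
      (fun x => c x k) := by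
    intro k x
    obtain ⟨V, hV, i, e, n, f, hn, hf, hs⟩ := s.2 x
    obtain ⟨q, hq, hqn⟩ := hspan e n hn
    have hfV : ∀ y : V, h * f ∉ y.1.asHomogeneousIdeal.toIdeal := fun y hy =>
      (y.1.isPrime.mem_or_mem hy).elim (hU _ (i y).2) (hs y).1
    refine ⟨V, hV, i, a + e, ⟨q k, hq k⟩, ⟨h * f, SetLike.mul_mem_graded hh hf⟩, hfV, fun y => ?_⟩
    obtain ⟨hfy, hy⟩ := hs y
    refine congrFun (eq_of_sum_eq hm y.1 (c (i y)) (fun k => HomogeneousLocalization.mk ⟨a + e, ⟨q k, hq k⟩,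
      ⟨h * f, SetLike.mul_mem_graded hh hf⟩, hfV y⟩) ?_) k
    exact (hc (i y)).symm.trans (hy.trans
      (mk_eq_sum m y.1 hf hh hfy (hU _ (i y).2) q hq hqn (hfV y)))
  obtain ⟨b, hb⟩ : ∃ b : I → (Proj 𝒜).ringCatSheaf.obj.obj U, ∀ k x,
      (show (ProjectiveSpectrum.Proj.structureSheaf 𝒜).1.obj U from b k).1 x = c x k :=
    ⟨fun k => show (ProjectiveSpectrum.Proj.structureSheaf 𝒜).1.obj U from
      ⟨fun x => c x k, hcl k⟩, fun _ _ => rfl⟩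
  refine ⟨b, ?_, ?_⟩
  · refine Subtype.ext (funext fun x => ?_)
    refine (hc x).trans ((sum_apply 𝒜 𝒩 b (fun i => ofDegreeZero 𝒜 𝒩 U (m i) (hm0 i)) x).trans
      (Finset.sum_congr rfl fun i _ => ?_)).symm
    exact congrArg (fun t : Stalk 𝒜 x.1 =>
      t.val • (LocalizedModule.mk (m i) 1 : Loc 𝒜 N x.1)) (hb i x)
  · intro c' hc'
    funext k
    refine Subtype.ext (funext fun x => ?_)
    refine congrFun (eq_of_sum_eq hm x.1 (fun k => (show (ProjectiveSpectrum.Proj.structureSheaf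
      𝒜).1.obj U from c' k).1 x) (c x) ?_) k |>.trans (hb k x).symm
    exact (sum_apply 𝒜 𝒩 c' (fun i => ofDegreeZero 𝒜 𝒩 U (m i) (hm0 i)) x).symm.trans
      ((congrArg (fun t : sections 𝒜 𝒩 U => t.1 x) hc').symm.trans (hc x))

end ProjTilde

open ProjTilde in
/-- The sheaf associated to `N` is locally free on an open set if, near each point, there are
linearly independent elements of degree zero whose span contains a homogeneous multiple of `N`. -/
theorem isLocallyFree_projTilde_restrict {σ A N : Type} [CommRing A] [SetLike σ A]
    [AddSubgroupClass σ A] (𝒜 : ℕ → σ) [GradedRing 𝒜] [AddCommGroup N] [Module A N]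
    (𝒩 : ℕ → AddSubgroup N) [SetLike.GradedSMul 𝒜 𝒩] (U' : (Proj 𝒜).Opens)
    (H : ∀ x ∈ U', ∃ (I : Type) (_ : Fintype I) (m : I → N) (a : ℕ) (h : A),
      LinearIndependent A m ∧ (∀ i, m i ∈ 𝒩 0) ∧ h ∈ 𝒜 a ∧ h ∉ x.asHomogeneousIdeal.toIdeal ∧
      ∀ e, ∀ n ∈ 𝒩 e, ∃ q : I → A, (∀ i, q i ∈ 𝒜 (a + e)) ∧ h • n = ∑ i, q i • m i) :
    SheafOfModules.IsLocallyFree (R := U'.toScheme.ringCatSheaf)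
      ((projTilde 𝒜 𝒩).restrict U'.ι) := by
  apply AlgebraicGeometry.Scheme.Modules.isLocallyFree_restrict
  intro x hx
  obtain ⟨I, _, m, a, h, hm, hm0, hh, hhx, hspan⟩ := H x hx
  refine ⟨Proj.basicOpen 𝒜 h, hhx, I, inferInstance,
    fun i => ofDegreeZero 𝒜 𝒩 (op (Proj.basicOpen 𝒜 h)) (m i) (hm0 i), fun V hV s => ?_⟩
  exact existsUnique_eq_sum 𝒜 𝒩 hm hm0 hh hspan (op V) (fun y hy => hV hy) s

/-! ### Taylor expansion of the columns -/

namespace BinaryForm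

section Homogenization

variable {S : Type*} [CommRing S] [Algebra ℂ S]

/-- The homogenization of degree `d` of a univariate polynomial, evaluated at a pair. -/
def homEval (d : ℕ) (g : Polynomial ℂ) (p q : S) : S :=
  ∑ m ∈ Finset.range (d + 1), algebraMap ℂ S (g.coeff m) * p ^ (d - m) * q ^ m

theorem aeval_hasseDeriv {d : ℕ} {g : Polynomial ℂ} (hg : g.natDegree ≤ d) (k : ℕ) (z : S) :
    Polynomial.aeval z (Polynomial.hasseDeriv k g) =
      ∑ m ∈ Finset.range (d + 1), algebraMap ℂ S (g.coeff m) * m.choose k * z ^ (m - k) := by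
  rw [Polynomial.hasseDeriv_apply, Polynomial.sum_over_range' _ _ (d + 1) (by omega), map_sum]
  · refine Finset.sum_congr rfl fun m _ => ?_
    rw [Polynomial.aeval_monomial, map_mul, map_natCast]
    ring
  · simp

/-- Expand (zp + y)^m by the binomial theorem and collect the powers of y. -/
theorem homEval_taylor {d : ℕ} {g : Polynomial ℂ} (hg : g.natDegree ≤ d) (p y z : S) :
    homEval d g p (z * p + y) = ∑ k ∈ Finset.range (d + 1),
      Polynomial.aeval z (Polynomial.hasseDeriv k g) * p ^ (d - k) * y ^ k := by
  simp only [aeval_hasseDeriv hg, Finset.sum_mul]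
  rw [Finset.sum_comm]
  refine Finset.sum_congr rfl fun m hm => ?_
  have hm : m ≤ d := by simpa [Nat.lt_succ_iff] using hm
  rw [add_comm, add_pow, Finset.mul_sum,
    ← Finset.sum_subset (Finset.range_mono (Nat.succ_le_succ hm))]
  · refine Finset.sum_congr rfl fun k hk => ?_
    have hk : k ≤ m := by simpa [Nat.lt_succ_iff] using hk
    have : d - k = (d - m) + (m - k) := by omega
    rw [this, pow_add, mul_pow]
    ring
  · intro k _ hk
    rw [Nat.choose_eq_zero_of_lt (by simpa using hk)]
    simp

/-- The coefficients of `g` after the substitution of `α + β t` and `γ + δ t`. -/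
def substCoeff (d : ℕ) (A : Fin 2 → Fin 2 → S) (g : Polynomial ℂ) (j : ℕ) : S :=
  (homEval d g (Polynomial.C (A 0 0) + Polynomial.C (A 0 1) * Polynomial.X)
    (Polynomial.C (A 1 0) + Polynomial.C (A 1 1) * Polynomial.X)).coeff j

/-- The second linear form is z times the first plus εt with ε = `A 1 1 - z * A 0 1`. In the Taylor
expansion the k-th term carries the factor t^k, hence contributes only to coefficients j ≥ k: this
is the source of triangularity. -/
theorem substCoeff_eq_sum {d : ℕ} {g : Polynomial ℂ} (hg : g.natDegree ≤ d)
    (A : Fin 2 → Fin 2 → S) {z : S} (hz : z * A 0 0 = A 1 0) {j : ℕ} (hj : j ≤ d) :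
    substCoeff d A g j = ∑ k ∈ Finset.range (j + 1),
      ((Polynomial.C (A 0 0) + Polynomial.C (A 0 1) * Polynomial.X) ^ (d - k)).coeff (j - k) *
        ((A 1 1 - z * A 0 1) ^ k * Polynomial.aeval z (Polynomial.hasseDeriv k g)) := by
  have h : Polynomial.C (A 1 0) + Polynomial.C (A 1 1) * Polynomial.X =
      Polynomial.C z * (Polynomial.C (A 0 0) + Polynomial.C (A 0 1) * Polynomial.X) +
        Polynomial.C (A 1 1 - z * A 0 1) * Polynomial.X := by
    rw [← hz]
    simp only [map_sub, map_mul]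
    ring
  have h' : ∀ k, Polynomial.aeval (Polynomial.C z) (Polynomial.hasseDeriv k g) =
      Polynomial.C (Polynomial.aeval z (Polynomial.hasseDeriv k g)) := fun k => by
    have := Polynomial.aeval_algHom_apply (Polynomial.CAlgHom (R := ℂ) (A := S)) z
      (Polynomial.hasseDeriv k g)
    simpa using this
  rw [substCoeff, h, homEval_taylor hg, Polynomial.finsetSum_coeff]
  have h2 : ∀ k, (Polynomial.aeval (Polynomial.C z) (Polynomial.hasseDeriv k g) *
      (Polynomial.C (A 0 0) + Polynomial.C (A 0 1) * Polynomial.X) ^ (d - k) *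
      (Polynomial.C (A 1 1 - z * A 0 1) * Polynomial.X) ^ k).coeff j =
      if k ≤ j then
      ((Polynomial.C (A 0 0) + Polynomial.C (A 0 1) * Polynomial.X) ^ (d - k)).coeff (j - k) *
        ((A 1 1 - z * A 0 1) ^ k * Polynomial.aeval z (Polynomial.hasseDeriv k g)) else 0 := by
    intro k
    rw [h', mul_pow, ← map_pow, ← mul_assoc, Polynomial.coeff_mul_X_pow']
    split_ifs
    · rw [Polynomial.coeff_mul_C, Polynomial.coeff_C_mul]
      ring
    · rfl
  rw [Finset.sum_congr rfl fun k _ => h2 k,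
    ← Finset.sum_subset (Finset.range_mono (Nat.succ_le_succ hj))]
  · refine Finset.sum_congr rfl fun k hk => if_pos (by simpa [Nat.lt_succ_iff] using hk)
  · intro k _ hk
    exact if_neg (by simpa [Nat.lt_succ_iff] using hk)

end Homogenization

section Triangular

variable {S M : Type*} [CommRing S] [AddCommGroup M] [Module S M]

/-- A triangular change of generators with invertible diagonal preserves spans. -/
theorem span_image_eq_of_triangular {d : ℕ} (v w : ℕ → M) (L : ℕ → ℕ → S)
    (hv : ∀ j ≤ d, v j = ∑ k ∈ Finset.range (j + 1), L j k • w k) (hL : ∀ j ≤ d, IsUnit (L j j))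
    {n : ℕ} (hn : n ≤ d) :
    Submodule.span S (v '' Set.Iic n) = Submodule.span S (w '' Set.Iic n) := by
  apply le_antisymm
  · rw [Submodule.span_le]
    rintro _ ⟨j, hj, rfl⟩
    rw [hv j (le_trans hj hn)]
    refine Submodule.sum_mem _ fun k hk => Submodule.smul_mem _ _ (Submodule.subset_span ⟨k, ?_, rfl⟩)
    exact le_trans (Nat.lt_succ_iff.1 (Finset.mem_range.1 hk)) hj
  · rw [Submodule.span_le]
    rintro _ ⟨j, hj, rfl⟩
    induction j using Nat.strong_induction_on with
    | _ j ih =>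
      have hjd : j ≤ d := le_trans hj hn
      have h := hv j hjd
      rw [Finset.sum_range_succ] at h
      have h2 : L j j • w j ∈ Submodule.span S (v '' Set.Iic n) := by
        rw [eq_sub_of_add_eq' h.symm]
        refine sub_mem (Submodule.subset_span ⟨j, hj, rfl⟩) (Submodule.sum_mem _ fun k hk => ?_)
        have hk := Finset.mem_range.1 hk
        exact Submodule.smul_mem _ _ (ih k hk (le_trans hk.le hj))
      exact (Submodule.smul_mem_iff_of_isUnit _ (hL j hjd)).1 h2

end Triangular

theorem exists_eq_sum_smul_col {S ι : Type*} [CommRing S] [Fintype ι] [DecidableEq ι]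
    {M : Matrix ι ι S} (hM : IsUnit M.det) (y : ι → S) :
    ∃ c : ι → S, y = ∑ k, c k • fun i => M i k := by
  refine ⟨M⁻¹.mulVec y, ?_⟩
  have : M.mulVec (M⁻¹.mulVec y) = y := by
    rw [Matrix.mulVec_mulVec, Matrix.mul_nonsing_inv _ hM, Matrix.one_mulVec]
  conv_lhs => rw [← this]
  funext i
  simp [Matrix.mulVec, dotProduct, mul_comm]

section LocalStructure

variable {S : Type*} [CommRing S] [Algebra ℂ S] {b d : ℕ} {g : Fin (b + 1) → Polynomial ℂ}

/-- The vector of `k`-th Taylor coefficients at `z`. -/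
def taylorVec (g : Fin (b + 1) → Polynomial ℂ) (z : S) (k : ℕ) : Fin (b + 1) → S :=
  fun i => Polynomial.aeval z (Polynomial.hasseDeriv k (g i))

/-- The columns of the coefficient matrix after the substitution of `α + β t` and `γ + δ t`. -/
def substVec (d : ℕ) (A : Fin 2 → Fin 2 → S) (g : Fin (b + 1) → Polynomial ℂ) (j : ℕ) :
    Fin (b + 1) → S :=
  fun i => substCoeff d A (g i) j

/-- The diagonal entries of the triangular transition are the constant coefficients of (α + βt)^(d −
j), that is, the units α^(d − j). -/
theorem span_substVec (hg : ∀ i, (g i).natDegree ≤ d) {A : Fin 2 → Fin 2 → S} {z : S}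
    (hA : IsUnit (A 0 0)) (hz : z * A 0 0 = A 1 0) {n : ℕ} (hn : n ≤ d) :
    Submodule.span S (substVec d A g '' Set.Iic n) =
      Submodule.span S ((fun k => (A 1 1 - z * A 0 1) ^ k • taylorVec g z k) '' Set.Iic n) := by
  refine span_image_eq_of_triangular _ _ (fun j k => ((Polynomial.C (A 0 0) +
    Polynomial.C (A 0 1) * Polynomial.X) ^ (d - k)).coeff (j - k)) (fun j hj => ?_)
    (fun j _ => ?_) hn
  · funext i
    simpa [substVec, taylorVec] using substCoeff_eq_sum (hg i) A hz hj
  · simpa [Polynomial.coeff_zero_eq_eval_zero] using hA.pow (d - j)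

/-- An invertible Wronskian makes w_0, …, w_b a basis, and ε^n w_k is a multiple of the generator
ε^k w_k because k ≤ b ≤ n. -/
theorem pow_smul_mem_span_substVec (hg : ∀ i, (g i).natDegree ≤ d) (hbd : b ≤ d)
    {A : Fin 2 → Fin 2 → S} {z : S} (hA : IsUnit (A 0 0)) (hz : z * A 0 0 = A 1 0)
    (hW : IsUnit (Matrix.of fun i k : Fin (b + 1) => taylorVec g z k i).det) {n : ℕ} (hn : b ≤ n)
    (y : Fin (b + 1) → S) :
    (A 1 1 - z * A 0 1) ^ n • y ∈ Submodule.span S (substVec d A g '' Set.Iic b) := by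
  rw [span_substVec hg hA hz hbd]
  obtain ⟨c, rfl⟩ := exists_eq_sum_smul_col hW y
  rw [Finset.smul_sum]
  refine Submodule.sum_mem _ fun k _ => ?_
  have hk : (k : ℕ) ≤ b := Nat.lt_succ_iff.1 k.2
  have : (A 1 1 - z * A 0 1) ^ n • c k • (fun i => Matrix.of
      (fun i k : Fin (b + 1) => taylorVec g z k i) i k) =
      ((A 1 1 - z * A 0 1) ^ (n - k) * c k) • (A 1 1 - z * A 0 1) ^ (k : ℕ) • taylorVec g z k := by
    obtain ⟨r, rfl⟩ := Nat.exists_eq_add_of_le (hk.trans hn)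
    rw [smul_smul, smul_smul, Nat.add_sub_cancel_left, pow_add]
    congr 1
    ring
  rw [this]
  exact Submodule.smul_mem _ _ (Submodule.subset_span ⟨k, hk, rfl⟩)

theorem substVec_mem_span (hg : ∀ i, (g i).natDegree ≤ d) (hbd : b ≤ d)
    {A : Fin 2 → Fin 2 → S} {z : S} (hA : IsUnit (A 0 0)) (hz : z * A 0 0 = A 1 0)
    (hW : IsUnit (Matrix.of fun i k : Fin (b + 1) => taylorVec g z k i).det) {j : ℕ} (hj : j ≤ d) :
    substVec d A g j ∈ Submodule.span S (substVec d A g '' Set.Iic b) := by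
  have h : substVec d A g j ∈ Submodule.span S (substVec d A g '' Set.Iic d) :=
    Submodule.subset_span ⟨j, hj, rfl⟩
  rw [span_substVec hg hA hz le_rfl] at h
  refine Submodule.span_le.2 ?_ h
  rintro _ ⟨k, -, rfl⟩
  rcases le_total b k with hk | hk
  · exact pow_smul_mem_span_substVec hg hbd hA hz hW hk _
  · rw [span_substVec hg hA hz hbd]
    exact Submodule.subset_span ⟨k, hk, rfl⟩

theorem algebraMap_coeff_eq_sum {d : ℕ} {g : Polynomial ℂ} (hg : g.natDegree ≤ d) (z : S) {m : ℕ}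
    (hm : m ≤ d) : algebraMap ℂ S (g.coeff m) = ∑ k ∈ Finset.range (d + 1),
      ((Polynomial.X - Polynomial.C z) ^ k).coeff m *
        Polynomial.aeval z (Polynomial.hasseDeriv k g) := by
  -- With p = 1 and y = X − z this is the expansion of g(X) in powers of X − z, from which the
  -- coefficient of X^m is read off.
  have h := homEval_taylor hg (1 : Polynomial S) (Polynomial.X - Polynomial.C z) (Polynomial.C z)
  have h' : ∀ k, Polynomial.aeval (Polynomial.C z) (Polynomial.hasseDeriv k g) =
      Polynomial.C (Polynomial.aeval z (Polynomial.hasseDeriv k g)) := fun k => by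
    have := Polynomial.aeval_algHom_apply (Polynomial.CAlgHom (R := ℂ) (A := S)) z
      (Polynomial.hasseDeriv k g)
    simpa using this
  have h2 := congrArg (fun P => Polynomial.coeff P m) h
  simp only [homEval, h', mul_one, one_pow, add_sub_cancel, Polynomial.finsetSum_coeff,
    Polynomial.coeff_C_mul, Polynomial.algebraMap_apply, Polynomial.coeff_X_pow] at h2
  rw [Finset.sum_eq_single m] at h2
  · simpa [mul_comm] using h2
  · intro k _ hk
    simp [hk.symm]
  · intro h
    simp at h
    omega

/-- As ε is a unit, all the w_k lie in the span; they recover the coefficient vectors of the `g i`,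
among which an invertible minor is assumed. -/
theorem span_substVec_eq_top (hg : ∀ i, (g i).natDegree ≤ d)
    {A : Fin 2 → Fin 2 → S} {z : S} (hA : IsUnit (A 0 0)) (hz : z * A 0 0 = A 1 0)
    (he : IsUnit (A 1 1 - z * A 0 1)) (J : Fin (b + 1) → ℕ) (hJ : ∀ k, J k ≤ d)
    (hW : (Matrix.of fun i k : Fin (b + 1) => (g i).coeff (J k)).det ≠ 0) :
    Submodule.span S (substVec d A g '' Set.Iic d) = ⊤ := by
  rw [span_substVec hg hA hz le_rfl, eq_top_iff]
  intro y _
  have hW' : IsUnit ((Matrix.of fun i k : Fin (b + 1) => (g i).coeff (J k)).map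
      (algebraMap ℂ S)).det := by
    rw [← RingHom.mapMatrix_apply, ← RingHom.map_det]
    exact (IsUnit.mk0 _ hW).map _
  obtain ⟨c, rfl⟩ := exists_eq_sum_smul_col hW' y
  refine Submodule.sum_mem _ fun m _ => Submodule.smul_mem _ _ ?_
  have : (fun i => (Matrix.of fun i k : Fin (b + 1) => (g i).coeff (J k)).map (algebraMap ℂ S) i m) =
      ∑ k ∈ Finset.range (d + 1), ((Polynomial.X - Polynomial.C z) ^ k).coeff (J m) •
        taylorVec g z k := by
    funext i
    simpa [taylorVec] using algebraMap_coeff_eq_sum (hg i) z (hJ m)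
  rw [this]
  refine Submodule.sum_mem _ fun k hk => Submodule.smul_mem _ _ ?_
  refine (Submodule.smul_mem_iff_of_isUnit _ (he.pow k)).1 (Submodule.subset_span ⟨k, ?_, rfl⟩)
  exact Nat.lt_succ_iff.1 (Finset.mem_range.1 hk)

end LocalStructure

end BinaryForm

/-! ### Column bases over local rings -/

namespace BinaryForm

theorem reflect_linear_pow {S : Type*} [CommRing S] (a c : S) (n : ℕ) :
    ((Polynomial.C a + Polynomial.C c * Polynomial.X) ^ n).reflect n =
      (Polynomial.C c + Polynomial.C a * Polynomial.X) ^ n := by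
  have h1 : ∀ x y : S, (Polynomial.C x + Polynomial.C y * Polynomial.X).natDegree ≤ 1 := by
    intro x y
    compute_degree
  induction n with
  | zero => simp
  | succ n ih =>
    rw [pow_succ, Polynomial.reflect_mul _ _ _ (h1 _ _), ih, pow_succ]
    · congr 1
      ext m
      rw [Polynomial.coeff_reflect]
      rcases m with _ | _ | m
      · simp
      · simp
      · rw [Polynomial.revAt_eq_self_of_lt (by omega)]
        simp
    · simpa using Polynomial.natDegree_pow_le_of_le n (h1 a c)

section Swap

variable {S : Type*} [CommRing S] [Algebra ℂ S] {b d : ℕ}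

theorem homEval_reflect (d : ℕ) (g : Polynomial ℂ) (p q : S) :
    homEval d (g.reflect d) p q = homEval d g q p := by
  rw [homEval, homEval, ← Finset.sum_range_reflect]
  refine Finset.sum_congr rfl fun m hm => ?_
  have hm : m ≤ d := by simpa [Nat.lt_succ_iff] using hm
  have h1 : d + 1 - 1 - m = d - m := by omega
  rw [h1, Polynomial.coeff_reflect, Polynomial.revAt_le (by omega), Nat.sub_sub_self hm]
  ring

theorem natDegree_reflect_le {d : ℕ} {g : Polynomial ℂ} (hg : g.natDegree ≤ d) :
    (g.reflect d).natDegree ≤ d := by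
  rw [Polynomial.natDegree_le_iff_coeff_eq_zero]
  intro N hN
  rw [Polynomial.coeff_reflect, Polynomial.revAt_eq_self_of_lt hN]
  exact Polynomial.coeff_eq_zero_of_natDegree_lt (hg.trans_lt hN)

theorem substCoeff_swap_rows (A : Fin 2 → Fin 2 → S) (g : Polynomial ℂ) (j : ℕ) :
    substCoeff d (fun i => A (Fin.rev i)) (g.reflect d) j = substCoeff d A g j := by
  rw [substCoeff, homEval_reflect]
  rfl

/-- Exchanging the columns of `A` exchanges s and t after the substitution, which reverses the order
of the coefficients. -/
theorem substCoeff_swap_cols (A : Fin 2 → Fin 2 → S) (g : Polynomial ℂ) {j : ℕ} (hj : j ≤ d) :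
    substCoeff d (fun i k => A i (Fin.rev k)) g j = substCoeff d A g (d - j) := by
  have h : ∀ a c : S, ∀ n, ((Polynomial.C a + Polynomial.C c * Polynomial.X) ^ n).natDegree ≤ n := by
    intro x y n
    refine (Polynomial.natDegree_pow_le_of_le n
      (show (Polynomial.C x + Polynomial.C y * Polynomial.X).natDegree ≤ 1 by
        compute_degree)).trans (mul_one n).le
  simp only [substCoeff, homEval, Polynomial.finsetSum_coeff]
  refine Finset.sum_congr rfl fun m hm => ?_
  have hm : m ≤ d := by simpa [Nat.lt_succ_iff] using hm
  simp only [mul_assoc, Polynomial.algebraMap_apply, Polynomial.coeff_C_mul]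
  congr 1
  have hr : ∀ P : Polynomial S, P.coeff (d - j) = (P.reflect d).coeff j := fun P => by
    rw [Polynomial.coeff_reflect, Polynomial.revAt_le hj]
  obtain ⟨r, rfl⟩ := Nat.exists_eq_add_of_le hm
  rw [hr, Nat.add_sub_cancel_left, Nat.add_comm m r, Polynomial.reflect_mul _ _ (h _ _ _) (h _ _ _),
    reflect_linear_pow, reflect_linear_pow]
  rfl

end Swap

section Wronskian

variable {b : ℕ} (g : Fin (b + 1) → Polynomial ℂ)

/-- The Wronskian, up to a constant factor. -/
def wronskian {K : Type*} [CommRing K] (g : Fin (b + 1) → Polynomial K) : Polynomial K :=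
  (Matrix.of fun i k : Fin (b + 1) => Polynomial.hasseDeriv k (g i)).det

/-- The determinant of the top coefficients. -/
def topMinor {K : Type*} [CommRing K] (g : Fin (b + 1) → Polynomial K) (d : ℕ) : K :=
  (Matrix.of fun i k : Fin (b + 1) => (g i).coeff (d - k)).det

theorem aeval_wronskian {S : Type*} [CommRing S] [Algebra ℂ S] (z : S) :
    Polynomial.aeval z (wronskian g) =
      (Matrix.of fun i k : Fin (b + 1) => taylorVec g z k i).det := by
  rw [wronskian, AlgHom.map_det]
  rfl

/-- Hasse derivatives at 0 are coefficients, and reflection turns the lowest ones into the highest: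
`topMinor` is the value of the Wronskian at infinity. -/
theorem eval_zero_wronskian_reflect {d : ℕ} (hbd : b ≤ d) :
    (wronskian fun i => (g i).reflect d).eval 0 = topMinor g d := by
  have := aeval_wronskian (fun i => (g i).reflect d) (0 : ℂ)
  rw [Polynomial.coe_aeval_eq_eval] at this
  rw [this, topMinor]
  congr 1
  ext i k
  have hk : (k : ℕ) ≤ d := (Nat.lt_succ_iff.1 k.2).trans hbd
  simp [taylorVec, ← Polynomial.coeff_zero_eq_eval_zero, Polynomial.hasseDeriv_coeff,
    Polynomial.coeff_reflect, Polynomial.revAt_le hk]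

end Wronskian

theorem exists_det_ne_zero {K : Type*} [Field K] {n d : ℕ} (v : ℕ → Fin n → K)
    (hv : Submodule.span K (v '' Set.Iic d) = ⊤) :
    ∃ J : Fin n → ℕ, (∀ k, J k ≤ d) ∧ (Matrix.of fun i k => v (J k) i).det ≠ 0 := by
  obtain ⟨κ, a, -, hspan, hli⟩ := exists_linearIndependent' K (fun j : Set.Iic d => v j)
  have hr : Set.range (fun j : Set.Iic d => v j) = v '' Set.Iic d := by
    ext; simp
  rw [hr, hv] at hspan
  let B := Module.Basis.mk hli hspan.ge
  have : Finite κ := Module.Finite.finite_basis B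
  have := Fintype.ofFinite κ
  have hc : Fintype.card κ = Fintype.card (Fin n) := by
    rw [← Module.finrank_eq_card_basis B, Module.finrank_fintype_fun_eq_card]
  let e := (Fintype.equivOfCardEq hc).symm
  refine ⟨fun k => a (e k), fun k => (a (e k)).2, ?_⟩
  have hli' := hli.comp e e.injective
  have := Matrix.linearIndependent_rows_iff_isUnit (A := Matrix.of fun k i => v (a (e k)) i)
  have h2 := this.1 hli'
  rw [Matrix.isUnit_iff_isUnit_det, ← Matrix.det_transpose] at h2
  exact h2.ne_zero

/-- Expressing e times the standard basis through the vectors gives a matrix identity CV = e·1, so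
det C · det V = e^n ≠ 0. -/
theorem det_ne_zero_of_smul_mem_span {S : Type*} [CommRing S] [IsDomain S] {n : ℕ} (v : Fin n → Fin n → S) {e : S}
    (he : e ≠ 0) (h : ∀ y, e • y ∈ Submodule.span S (Set.range v)) :
    (Matrix.of fun i k => v k i).det ≠ 0 := by
  choose c hc using fun i => (Submodule.mem_span_range_iff_exists_fun S).1 (h (Pi.single i 1))
  have : (Matrix.of c) * (Matrix.of v) = e • (1 : Matrix (Fin n) (Fin n) S) := by
    ext i j
    have := congrFun (hc i) j
    simp only [Finset.sum_apply, Pi.smul_apply, smul_eq_mul] at this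
    simp only [Matrix.mul_apply, Matrix.of_apply, Matrix.smul_apply, smul_eq_mul, this,
      Matrix.one_apply, Pi.single_apply, eq_comm]
  intro h0
  have h1 := congrArg Matrix.det this
  rw [Matrix.det_mul, ← Matrix.det_transpose (Matrix.of v)] at h1
  change _ * (Matrix.of fun i k => v k i).det = _ at h1
  rw [h0, mul_zero, Matrix.det_smul, Matrix.det_one, mul_one] at h1
  exact pow_ne_zero _ he h1.symm

section LocalRing

variable {S : Type*} [CommRing S] [Algebra ℂ S] {b d : ℕ} {g : Fin (b + 1) → Polynomial ℂ}

/-- The conclusion of the local analysis: some `b + 1` columns are linearly independent and generate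
the module of columns. -/
def HasColumnBasis (d : ℕ) (A : Fin 2 → Fin 2 → S) (g : Fin (b + 1) → Polynomial ℂ) : Prop :=
  ∃ J : Fin (b + 1) → ℕ, (∀ k, J k ≤ d) ∧ (Matrix.of fun i k => substVec d A g (J k) i).det ≠ 0 ∧
    ∀ j ≤ d, substVec d A g j ∈ Submodule.span S (Set.range fun k => substVec d A g (J k))

theorem hasColumnBasis_of_isUnit_wronskian [IsDomain S] (hg : ∀ i, (g i).natDegree ≤ d)
    (hbd : b ≤ d) {A : Fin 2 → Fin 2 → S} {z : S} (hA : IsUnit (A 0 0)) (hz : z * A 0 0 = A 1 0)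
    (hW : IsUnit (Polynomial.aeval z (wronskian g))) (he : A 1 1 - z * A 0 1 ≠ 0) :
    HasColumnBasis d A g := by
  rw [aeval_wronskian] at hW
  have hr : (Set.range fun k : Fin (b + 1) => substVec d A g k) = substVec d A g '' Set.Iic b := by
    ext y
    constructor
    · rintro ⟨k, rfl⟩
      exact ⟨k, Nat.lt_succ_iff.1 k.2, rfl⟩
    · rintro ⟨k, hk, rfl⟩
      exact ⟨⟨k, Nat.lt_succ_iff.2 hk⟩, rfl⟩
  refine ⟨fun k => k, fun k => (Nat.lt_succ_iff.1 k.2).trans hbd, ?_, fun j hj => ?_⟩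
  · refine det_ne_zero_of_smul_mem_span (fun k : Fin (b + 1) => substVec d A g k)
      (pow_ne_zero b he) fun y => ?_
    rw [hr]
    exact pow_smul_mem_span_substVec hg hbd hA hz hW le_rfl y
  · rw [hr]
    exact substVec_mem_span hg hbd hA hz hW hj

theorem hasColumnBasis_swap_rows {A : Fin 2 → Fin 2 → S}
    (h : HasColumnBasis d (fun i => A (Fin.rev i)) fun i => (g i).reflect d) :
    HasColumnBasis d A g := by
  have : substVec d (fun i => A (Fin.rev i)) (fun i => (g i).reflect d) = substVec d A g := by
    funext j i
    exact substCoeff_swap_rows A (g i) j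
  unfold HasColumnBasis at h ⊢
  rwa [this] at h

theorem hasColumnBasis_swap_cols {A : Fin 2 → Fin 2 → S}
    (h : HasColumnBasis d (fun i k => A i (Fin.rev k)) g) : HasColumnBasis d A g := by
  have : ∀ j ≤ d, substVec d (fun i k => A i (Fin.rev k)) g j = substVec d A g (d - j) := by
    intro j hj
    funext i
    exact substCoeff_swap_cols A (g i) hj
  obtain ⟨J, hJ, hdet, hspan⟩ := h
  have h2 : ∀ k, substVec d (fun i k => A i (Fin.rev k)) g (J k) = substVec d A g (d - J k) :=
    fun k => this _ (hJ k)
  simp only [h2] at hdet hspan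
  refine ⟨fun k => d - J k, fun k => Nat.sub_le _ _, hdet, fun j hj => ?_⟩
  have h3 := hspan (d - j) (Nat.sub_le _ _)
  rwa [this _ (Nat.sub_le _ _), Nat.sub_sub_self hj] at h3

theorem substVec_map {T : Type*} [CommRing T] [Algebra ℂ T] (φ : S →ₐ[ℂ] T)
    (A : Fin 2 → Fin 2 → S) (j : ℕ) (i : Fin (b + 1)) :
    substVec d (fun a c => φ (A a c)) g j i = φ (substVec d A g j i) := by
  simp only [substVec, substCoeff]
  have : ∀ P : Polynomial S, φ (P.coeff j) = (Polynomial.mapAlgHom φ P).coeff j := fun P => by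
    simp
  rw [this]
  congr 1
  simp [homEval]

/-- Over ℂ the polynomial splits, so its value at z is a nonzero constant times a product of
differences z − ρ. -/
theorem isUnit_aeval_of_roots {z : S} {p : Polynomial ℂ} (hp : p ≠ 0)
    (h : ∀ ρ, p.IsRoot ρ → IsUnit (z - algebraMap ℂ S ρ)) : IsUnit (Polynomial.aeval z p) := by
  have hs := (IsAlgClosed.splits p).eq_prod_roots
  rw [hs, map_mul, map_multiset_prod, Multiset.map_map]
  refine IsUnit.mul ?_ ?_
  · rw [Polynomial.aeval_C]
    exact (IsUnit.mk0 _ (by simpa using hp)).map _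
  · have : ∀ m : Multiset ℂ, (∀ ρ ∈ m, p.IsRoot ρ) → IsUnit (Multiset.map
        (⇑(Polynomial.aeval z) ∘ fun a => Polynomial.X - Polynomial.C a) m).prod := by
      intro m
      induction m using Multiset.induction_on with
      | empty => simp
      | cons a m ih =>
        intro hm
        rw [Multiset.map_cons, Multiset.prod_cons]
        refine IsUnit.mul ?_ (ih fun ρ hρ => hm ρ (Multiset.mem_cons_of_mem hρ))
        simpa using h a (hm a (Multiset.mem_cons_self _ _))
    exact this _ fun ρ hρ => Polynomial.isRoot_of_mem_roots hρ

variable [IsLocalRing S]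

/-- Columns which generate over the residue field of a local ring. -/
theorem hasColumnBasis_of_residue (A : Fin 2 → Fin 2 → S)
    (h : Submodule.span (IsLocalRing.ResidueField S)
      (substVec d (fun a c => IsLocalRing.residue S (A a c)) g '' Set.Iic d) = ⊤) :
    HasColumnBasis d A g := by
  obtain ⟨J, hJ, hdet⟩ := exists_det_ne_zero _ h
  let φ : S →ₐ[ℂ] IsLocalRing.ResidueField S := IsScalarTower.toAlgHom ℂ S _
  have h1 : (Matrix.of fun i k => substVec d (fun a c => IsLocalRing.residue S (A a c)) g (J k) i) =
      φ.mapMatrix (Matrix.of fun i k => substVec d A g (J k) i) := by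
    ext i k
    exact substVec_map φ A (J k) i
  rw [h1, ← AlgHom.map_det] at hdet
  -- A minor that is nonzero in the residue field is a unit, so these columns generate the whole
  -- free module.
  have hu : IsUnit (Matrix.of fun i k => substVec d A g (J k) i).det :=
    (IsLocalRing.residue_ne_zero_iff_isUnit _).1 hdet
  refine ⟨J, hJ, hu.ne_zero, fun j _ => ?_⟩
  obtain ⟨c, hc⟩ := exists_eq_sum_smul_col hu (substVec d A g j)
  rw [hc]
  exact Submodule.sum_mem _ fun k _ => Submodule.smul_mem _ _ (Submodule.subset_span ⟨k, rfl⟩)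

/-- p(z) is congruent modulo z to p(0), a nonzero constant, and z lies in the maximal ideal. -/
theorem isUnit_aeval_of_eval_zero_ne_zero {z : S} (hz : ¬IsUnit z) {p : Polynomial ℂ}
    (hp : p.eval 0 ≠ 0) : IsUnit (Polynomial.aeval z p) := by
  have hdvd : z ∣ Polynomial.aeval z p - algebraMap ℂ S (p.eval 0) := by
    have h1 : Polynomial.aeval z p = (p.map (algebraMap ℂ S)).eval z := by
      rw [Polynomial.eval_map_algebraMap]
    have h2 : algebraMap ℂ S (p.eval 0) = (p.map (algebraMap ℂ S)).eval 0 := by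
      rw [← map_zero (algebraMap ℂ S), Polynomial.eval_map_apply]
    have := Polynomial.sub_dvd_eval_sub z 0 (p.map (algebraMap ℂ S))
    rwa [sub_zero, ← h1, ← h2] at this
  have h0 : Polynomial.aeval z p - algebraMap ℂ S (p.eval 0) ∈ IsLocalRing.maximalIdeal S :=
    Ideal.mem_of_dvd _ hdvd ((IsLocalRing.mem_maximalIdeal _).2 hz)
  by_contra hn
  have h1 := sub_mem ((IsLocalRing.mem_maximalIdeal _).2 hn) h0
  rw [sub_sub_cancel] at h1
  exact (IsLocalRing.mem_maximalIdeal _).1 h1 ((IsUnit.mk0 _ hp).map _)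

/-- If the determinant is a unit, the columns already span over the residue field. Otherwise the
Wronskian must be a unit: at γ/α by the assumption on its roots, or, when α is a non-unit, at α/γ
for the reflected forms. -/
theorem hasColumnBasis_of_isUnit_col [IsDomain S] (hg : ∀ i, (g i).natDegree ≤ d) (hbd : b ≤ d)
    (htop : topMinor g d ≠ 0) (hw : wronskian g ≠ 0) {A : Fin 2 → Fin 2 → S}
    (hΔ : A 0 0 * A 1 1 - A 0 1 * A 1 0 ≠ 0) (hA : IsUnit (A 0 0) ∨ IsUnit (A 1 0))
    (hbad : ∀ ρ, (wronskian g).IsRoot ρ → IsUnit (A 1 0 - algebraMap ℂ S ρ * A 0 0) ∨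
      IsUnit (A 1 1 - algebraMap ℂ S ρ * A 0 1)) : HasColumnBasis d A g := by
  by_cases hu : IsUnit (A 0 0 * A 1 1 - A 0 1 * A 1 0)
  · apply hasColumnBasis_of_residue
    have hu' := hu.map (IsLocalRing.residue S)
    rcases hA with hA | hA
    · obtain ⟨a, ha⟩ := hA.exists_left_inv
      refine span_substVec_eq_top (z := IsLocalRing.residue S (A 1 0 * a)) hg
        (hA.map (IsLocalRing.residue S)) ?_ ?_ (fun k => d - k) (fun _ => Nat.sub_le _ _) htop
      · rw [← map_mul, mul_assoc, ha, mul_one]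
      · have : A 0 0 * A 1 1 - A 0 1 * A 1 0 = A 0 0 * (A 1 1 - A 1 0 * a * A 0 1) := by
          linear_combination (A 0 1 * A 1 0) * ha
        rw [this, map_mul] at hu'
        simpa using isUnit_of_mul_isUnit_right hu'
    · obtain ⟨a, ha⟩ := hA.exists_left_inv
      have : substVec d (fun a c => IsLocalRing.residue S (A a c)) g =
          substVec d (fun a c => IsLocalRing.residue S (A (Fin.rev a) c))
            (fun i => (g i).reflect d) := by
        funext j i
        exact (substCoeff_swap_rows (fun a c => IsLocalRing.residue S (A a c)) (g i) j).symm
      rw [this]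
      refine span_substVec_eq_top (z := IsLocalRing.residue S (A 0 0 * a))
        (fun i => natDegree_reflect_le (hg i)) (hA.map (IsLocalRing.residue S)) ?_ ?_
        (fun k => k) (fun k => (Nat.lt_succ_iff.1 k.2).trans hbd) ?_
      · change _ * IsLocalRing.residue S (A 1 0) = IsLocalRing.residue S (A 0 0)
        rw [← map_mul, mul_assoc, ha, mul_one]
      · have : A 0 0 * A 1 1 - A 0 1 * A 1 0 = A 1 0 * (- (A 0 1 - A 0 0 * a * A 1 1)) := by
          linear_combination (- A 0 0 * A 1 1) * ha
        rw [this, map_mul] at hu'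
        have h2 := (isUnit_of_mul_isUnit_right hu')
        rw [map_neg, IsUnit.neg_iff] at h2
        simpa using h2
      · convert htop using 1
        rw [topMinor]
        congr 1
        ext i k
        simp [Polynomial.coeff_reflect,
          Polynomial.revAt_le ((Nat.lt_succ_iff.1 k.2).trans hbd)]
  · by_cases hα : IsUnit (A 0 0)
    · obtain ⟨a, ha⟩ := hα.exists_left_inv
      refine hasColumnBasis_of_isUnit_wronskian (z := A 1 0 * a) hg hbd hα ?_ ?_ ?_
      · rw [mul_assoc, ha, mul_one]
      · refine isUnit_aeval_of_roots hw fun ρ hρ => ?_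
        -- If γ − ρα were a non-unit, then so would be α(δ − ρβ) = (αδ − βγ) + β(γ − ρα), against
        -- `hbad`.
        have h1 : IsUnit (A 1 0 - algebraMap ℂ S ρ * A 0 0) := by
          by_contra h1
          have h2 := (hbad ρ hρ).resolve_left h1
          have h3 : A 0 0 * (A 1 1 - algebraMap ℂ S ρ * A 0 1) ∈ IsLocalRing.maximalIdeal S := by
            have : A 0 0 * (A 1 1 - algebraMap ℂ S ρ * A 0 1) =
              (A 0 0 * A 1 1 - A 0 1 * A 1 0) + A 0 1 * (A 1 0 - algebraMap ℂ S ρ * A 0 0) := by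
              ring
            rw [this]
            exact add_mem ((IsLocalRing.mem_maximalIdeal _).2 hu)
              (Ideal.mul_mem_left _ _ ((IsLocalRing.mem_maximalIdeal _).2 h1))
          exact (IsLocalRing.mem_maximalIdeal _).1 h3 (hα.mul h2)
        have h4 : A 1 0 - algebraMap ℂ S ρ * A 0 0 = A 0 0 * (A 1 0 * a - algebraMap ℂ S ρ) := by
          linear_combination (- A 1 0) * ha
        rw [h4] at h1
        exact isUnit_of_mul_isUnit_right h1
      · intro h0
        apply hΔ
        linear_combination (A 0 0) * h0 + (A 0 1 * A 1 0) * ha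
    · have hγ := hA.resolve_left hα
      obtain ⟨a, ha⟩ := hγ.exists_left_inv
      apply hasColumnBasis_swap_rows
      refine hasColumnBasis_of_isUnit_wronskian (z := A 0 0 * a)
        (fun i => natDegree_reflect_le (hg i)) hbd hγ ?_ ?_ ?_
      · change A 0 0 * a * A 1 0 = A 0 0
        rw [mul_assoc, ha, mul_one]
      -- Now z = α/γ is in the maximal ideal, so only the value of the reflected Wronskian at 0,
      -- which is `topMinor`, matters.
      · refine isUnit_aeval_of_eval_zero_ne_zero (fun h => hα (isUnit_of_mul_isUnit_left h)) ?_
        rwa [eval_zero_wronskian_reflect g hbd]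
      · intro h0
        apply hΔ
        change A 0 1 - A 0 0 * a * A 1 1 = 0 at h0
        linear_combination (- A 1 0) * h0 - (A 0 0 * A 1 1) * ha

/-- The local structure of the module of columns at a local ring. -/
theorem hasColumnBasis [IsDomain S] (hg : ∀ i, (g i).natDegree ≤ d) (hbd : b ≤ d)
    (htop : topMinor g d ≠ 0) (hw : wronskian g ≠ 0) {A : Fin 2 → Fin 2 → S}
    (hΔ : A 0 0 * A 1 1 - A 0 1 * A 1 0 ≠ 0) (hA : ∃ i k, IsUnit (A i k))
    (hbad : ∀ ρ, (wronskian g).IsRoot ρ → IsUnit (A 1 0 - algebraMap ℂ S ρ * A 0 0) ∨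
      IsUnit (A 1 1 - algebraMap ℂ S ρ * A 0 1)) : HasColumnBasis d A g := by
  by_cases h0 : IsUnit (A 0 0) ∨ IsUnit (A 1 0)
  · exact hasColumnBasis_of_isUnit_col hg hbd htop hw hΔ h0 hbad
  -- All units lie in the second column. Exchanging columns negates the determinant and exchanges
  -- the two alternatives of `hbad`.
  · apply hasColumnBasis_swap_cols
    refine hasColumnBasis_of_isUnit_col hg hbd htop hw ?_ ?_ fun ρ hρ => (hbad ρ hρ).symm
    · intro h
      apply hΔ
      change A 0 1 * A 1 0 - A 0 0 * A 1 1 = 0 at h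
      linear_combination -h
    · obtain ⟨i, k, hik⟩ := hA
      fin_cases i <;> fin_cases k
      · exact absurd (Or.inl hik) h0
      · exact Or.inl hik
      · exact absurd (Or.inr hik) h0
      · exact Or.inr hik

end LocalRing

end BinaryForm

/-! ### Dehomogenization and homogeneity of the matrix entries -/

namespace BinaryForm

section Dehomogenization

/-- Dehomogenization: `s ↦ 1`, `t ↦ X`. -/
def dehom (S : Type*) [CommRing S] : MvPolynomial (Fin 2) S →ₐ[S] Polynomial S :=
  aeval ![1, Polynomial.X]

variable {S : Type*} [CommRing S]

theorem eq_mono {d : ℕ} {m : Fin 2 →₀ ℕ} (h : m.degree = d) : m = mono d (m 1) := by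
  have : m 0 + m 1 = d := by simpa [Finsupp.degree_eq_sum] using h
  ext i
  fin_cases i
  · simp [mono]; omega
  · simp [mono]

theorem mono_apply_one (d j : ℕ) : mono d j 1 = j := by simp [mono]

theorem mono_injective (d : ℕ) : Function.Injective (mono d) := fun j k h => by
  simpa [mono_apply_one] using DFunLike.congr_fun h 1

theorem eq_sum_monomial {d : ℕ} {F : MvPolynomial (Fin 2) S} (hF : F.IsHomogeneous d) :
    F = ∑ j ∈ Finset.range (d + 1), monomial (mono d j) (coeff (mono d j) F) := by
  ext m
  simp only [coeff_sum, coeff_monomial]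
  by_cases hm : m.degree = d
  · have h1 : m 1 ≤ d := by
      rw [← hm, Finsupp.degree_eq_sum]
      simp
    rw [eq_mono hm, Finset.sum_eq_single (m 1), if_pos rfl]
    · intro k _ hk
      exact if_neg fun h => hk (mono_injective d h)
    · intro h
      simp at h
      omega
  · have h0 : coeff m F = 0 := hF.coeff_eq_zero hm
    rw [h0, Finset.sum_eq_zero]
    intro j hj
    split_ifs with h
    · rw [h, h0]
    · rfl

theorem dehom_eq_sum {d : ℕ} {F : MvPolynomial (Fin 2) S} (hF : F.IsHomogeneous d) :
    dehom S F = ∑ j ∈ Finset.range (d + 1), Polynomial.monomial j (coeff (mono d j) F) := by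
  conv_lhs => rw [eq_sum_monomial hF]
  rw [map_sum]
  refine Finset.sum_congr rfl fun j _ => ?_
  rw [dehom, aeval_monomial, ← Polynomial.C_mul_X_pow_eq_monomial, Finsupp.prod_fintype _ _ (by simp)]
  simp [mono]

theorem coeff_dehom {d : ℕ} {F : MvPolynomial (Fin 2) S} (hF : F.IsHomogeneous d) {j : ℕ}
    (hj : j ≤ d) : (dehom S F).coeff j = coeff (mono d j) F := by
  rw [dehom_eq_sum hF]
  simp only [Polynomial.finsetSum_coeff, Polynomial.coeff_monomial]
  rw [Finset.sum_eq_single j]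
  · simp
  · intro k _ hk
    exact if_neg hk
  · intro h
    simp at h
    omega

theorem natDegree_dehom_le {d : ℕ} {F : MvPolynomial (Fin 2) S} (hF : F.IsHomogeneous d) :
    (dehom S F).natDegree ≤ d := by
  rw [dehom_eq_sum hF]
  refine Polynomial.natDegree_sum_le_of_forall_le _ _ fun j hj => ?_
  exact (Polynomial.natDegree_monomial_le _).trans (Nat.lt_succ_iff.1 (Finset.mem_range.1 hj))

theorem aeval_eq_homEval [Algebra ℂ S] {d : ℕ} {F : MvPolynomial (Fin 2) ℂ} (hF : F.IsHomogeneous d)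
    (f : Fin 2 → S) : aeval f F = homEval d (dehom ℂ F) (f 0) (f 1) := by
  conv_lhs => rw [eq_sum_monomial hF]
  rw [map_sum, homEval]
  refine Finset.sum_congr rfl fun j hj => ?_
  rw [coeff_dehom hF (Nat.lt_succ_iff.1 (Finset.mem_range.1 hj)), aeval_monomial,
    Finsupp.prod_fintype _ _ (by simp)]
  simp [mono, mul_assoc]

end Dehomogenization

variable {b d : ℕ}

theorem coeffMatrix_eq (G : Fin (b + 1) → Forms d) (i : Fin (b + 1)) (j : Fin (d + 1)) :
    coeffMatrix G i j = substVec d (fun a c => (X (a, c) : R)) (fun i => dehom ℂ (G i).1) j i := by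
  have hh : (changeVariables (G i).1).IsHomogeneous d := by
    have := IsHomogeneous.aeval (n := 1) (G i).2
      (fun i => (C (X (i, 0)) * X 0 + C (X (i, 1)) * X 1 : MvPolynomial (Fin 2) R)) fun k =>
        ((isHomogeneous_C _ _).mul (isHomogeneous_X _ _)).add
          ((isHomogeneous_C _ _).mul (isHomogeneous_X _ _))
    rwa [one_mul] at this
  rw [coeffMatrix, ← coeff_dehom hh (Nat.lt_succ_iff.1 j.2), substVec, substCoeff]
  congr 1
  have h1 : dehom R (changeVariables (G i).1) =
      aeval (fun a : Fin 2 => (Polynomial.C (X (a, 0)) + Polynomial.C (X (a, 1)) * Polynomial.X :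
        Polynomial R)) (G i).1 := by
    have : ((dehom R).restrictScalars ℂ).comp changeVariables = aeval (fun a : Fin 2 =>
      (Polynomial.C (X (a, 0)) + Polynomial.C (X (a, 1)) * Polynomial.X : Polynomial R)) := by
      apply algHom_ext
      intro a
      simp [changeVariables, dehom]
    exact DFunLike.congr_fun this _
  rw [h1, aeval_eq_homEval (G i).2]

/-- A polynomial whose coefficients are homogeneous of degree `e`. -/
def HomCoeff (e : ℕ) (P : Polynomial R) : Prop := ∀ j, (P.coeff j).IsHomogeneous e

theorem HomCoeff.mul {e e' : ℕ} {P Q : Polynomial R} (hP : HomCoeff e P) (hQ : HomCoeff e' Q) :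
    HomCoeff (e + e') (P * Q) := fun j => by
  rw [Polynomial.coeff_mul]
  exact IsHomogeneous.sum _ _ _ fun p _ => (hP _).mul (hQ _)

theorem HomCoeff.pow {P : Polynomial R} (hP : HomCoeff 1 P) (n : ℕ) : HomCoeff n (P ^ n) := by
  induction n with
  | zero =>
    intro j
    rw [pow_zero, Polynomial.coeff_one]
    split_ifs
    exacts [isHomogeneous_one _ _, isHomogeneous_zero _ _ _]
  | succ n ih => rw [pow_succ]; exact ih.mul hP

theorem homCoeff_linear (a c : Fin 2 × Fin 2) :
    HomCoeff 1 (Polynomial.C (X a : R) + Polynomial.C (X c) * Polynomial.X) := fun j => by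
  rcases j with _ | _ | j
  · simpa using isHomogeneous_X _ _
  · simpa using isHomogeneous_X _ _
  · simpa [Polynomial.coeff_X, Polynomial.coeff_C] using isHomogeneous_zero _ _ _

theorem coeffMatrix_isHomogeneous (G : Fin (b + 1) → Forms d) (i : Fin (b + 1)) (j : Fin (d + 1)) :
    (coeffMatrix G i j).IsHomogeneous d := by
  rw [coeffMatrix_eq, substVec, substCoeff, homEval, Polynomial.finsetSum_coeff]
  refine IsHomogeneous.sum _ _ _ fun m hm => ?_
  rw [mul_assoc, IsScalarTower.algebraMap_apply ℂ R (Polynomial R), Polynomial.algebraMap_apply,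
    Algebra.algebraMap_self_apply, Polynomial.coeff_C_mul]
  have h := (isHomogeneous_C (Fin 2 × Fin 2) ((dehom ℂ (G i).1).coeff m)).mul
    (((homCoeff_linear (0, 0) (0, 1)).pow (d - m)).mul ((homCoeff_linear (1, 0) (1, 1)).pow m) j)
  rwa [zero_add, Nat.sub_add_cancel (Nat.lt_succ_iff.1 (Finset.mem_range.1 hm))] at h

end BinaryForm

/-! ### From local rings to the sheaf -/

namespace BinaryForm

variable {b d : ℕ}

/-- The localization of the coordinate ring at a homogeneous prime. -/
abbrev LocalRing (x : ProjectiveSpectrum grading) : Type :=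
  Localization.AtPrime x.asHomogeneousIdeal.toIdeal

/-- A column of the coefficient matrix, as an element of the module of columns. -/
def column (G : Fin (b + 1) → Forms d) (j : Fin (d + 1)) : columnModule G :=
  ⟨fun i => coeffMatrix G i j, Submodule.subset_span ⟨j, rfl⟩⟩

theorem column_mem (G : Fin (b + 1) → Forms d) (j : Fin (d + 1)) :
    column G j ∈ columnGrading G 0 := fun i => by
  rw [zero_add]
  exact coeffMatrix_isHomogeneous G i j

/-- Relations between columns over the local ring at a point come from homogeneous relations. -/
theorem exists_homogeneous_relation (G : Fin (b + 1) → Forms d) (x : ProjectiveSpectrum grading)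
    {J : Fin (b + 1) → Fin (d + 1)}
    (hJ : ∀ j, (fun i => algebraMap R (LocalRing x)
      (coeffMatrix G i j)) ∈ Submodule.span (LocalRing x) (Set.range fun k i =>
        algebraMap R (LocalRing x) (coeffMatrix G i (J k)))) :
    ∃ (a : ℕ) (h : R) (r : Fin (d + 1) → Fin (b + 1) → R), h ∈ grading a ∧
      h ∉ x.asHomogeneousIdeal.toIdeal ∧ (∀ j k, r j k ∈ grading a) ∧
      ∀ j i, h * coeffMatrix G i j = ∑ k, r j k * coeffMatrix G i (J k) := by
  set P := x.asHomogeneousIdeal.toIdeal with hP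
  have : P.IsPrime := x.isPrime
  choose c hc using fun j => (Submodule.mem_span_range_iff_exists_fun (LocalRing x)).1 (hJ j)
  obtain ⟨h, hh⟩ := IsLocalization.exist_integer_multiples_of_finite P.primeCompl
    (fun p : Fin (d + 1) × Fin (b + 1) => c p.1 p.2)
  choose r hr using hh
  have hrel : ∀ j i, h.1 * coeffMatrix G i j = ∑ k, r (j, k) * coeffMatrix G i (J k) := by
    intro j i
    apply IsLocalization.injective (LocalRing x) P.primeCompl_le_nonZeroDivisors
    rw [map_mul, map_sum]
    have h1 := congrFun (hc j) i
    simp only [Finset.sum_apply, Pi.smul_apply, smul_eq_mul] at h1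
    rw [← h1, Finset.mul_sum]
    refine Finset.sum_congr rfl fun k _ => ?_
    rw [map_mul, hr, Algebra.smul_def, mul_assoc]
  -- Since the prime is homogeneous, some component of the denominator avoids it. The matrix entries
  -- all have degree d, so the component of the relation in degree a + d is again a relation, now
  -- with coefficients of degree a.
  obtain ⟨a, ha⟩ : ∃ a, (DirectSum.decompose grading h.1 a : R) ∉ P := by
    by_contra hn
    push Not at hn
    exact h.2 ((x.asHomogeneousIdeal.isHomogeneous.mem_iff).2 hn)
  refine ⟨a, DirectSum.decompose grading h.1 a, fun j k => DirectSum.decompose grading (r (j, k)) a,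
    SetLike.coe_mem _, ha, fun j k => SetLike.coe_mem _, fun j i => ?_⟩
  have h2 := congrArg (fun f => (DirectSum.decompose grading f (a + d) : R)) (hrel j i)
  simp only [DirectSum.decompose_sum, DirectSum.sum_apply, AddSubmonoidClass.coe_finsetSum] at h2
  rw [DirectSum.coe_decompose_mul_add_of_right_mem _ (coeffMatrix_isHomogeneous G i j)] at h2
  rw [h2]
  exact Finset.sum_congr rfl fun k _ =>
    DirectSum.coe_decompose_mul_add_of_right_mem _ (coeffMatrix_isHomogeneous G i (J k))

theorem exists_homogeneous_combination (G : Fin (b + 1) → Forms d) {e : ℕ} {n : columnModule G}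
    (hn : n ∈ columnGrading G e) : ∃ p : Fin (d + 1) → R, (∀ j, p j ∈ grading e) ∧
      ∀ i, n.1 i = ∑ j, p j * coeffMatrix G i j := by
  obtain ⟨p, hp⟩ := (Submodule.mem_span_range_iff_exists_fun _).1 n.2
  refine ⟨fun j => DirectSum.decompose grading (p j) e, fun j => SetLike.coe_mem _, fun i => ?_⟩
  have h1 := congrArg (fun f => (DirectSum.decompose grading f (e + d) : R)) (congrFun hp i)
  simp only [Finset.sum_apply, Pi.smul_apply, smul_eq_mul, DirectSum.decompose_sum,
    DirectSum.sum_apply, AddSubmonoidClass.coe_finsetSum] at h1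
  rw [DirectSum.decompose_of_mem_same _ (hn i)] at h1
  rw [← h1]
  exact Finset.sum_congr rfl fun k _ =>
    DirectSum.coe_decompose_mul_add_of_right_mem _ (coeffMatrix_isHomogeneous G i k)

/-- If some columns form a basis over the local rings of all points of an open set, then the sheaf
is locally free there. -/
theorem isLocallyFree_sheafM (G : Fin (b + 1) → Forms d) (U' : P3.Opens)
    (H : ∀ x : ProjectiveSpectrum grading, (show P3 from x) ∈ U' →
      HasColumnBasis d (fun a c =>
        algebraMap R (LocalRing x) (X (a, c)))
        fun i => dehom ℂ (G i).1) :
    SheafOfModules.IsLocallyFree (R := U'.toScheme.ringCatSheaf) ((sheafM G).restrict U'.ι) := by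
  refine isLocallyFree_projTilde_restrict grading (columnGrading G) U'
    fun (x : ProjectiveSpectrum grading) hx => ?_
  obtain ⟨J, hJ, hdet, hspan⟩ := H x hx
  let φ : R →ₐ[ℂ] LocalRing x := IsScalarTower.toAlgHom ℂ R _
  have hφ : ∀ (j : Fin (d + 1)) i, substVec d (fun a c =>
      algebraMap R (LocalRing x) (X (a, c)))
        (fun i => dehom ℂ (G i).1) j i = algebraMap R _ (coeffMatrix G i j) := by
    intro j i
    rw [coeffMatrix_eq]
    exact substVec_map φ _ j i
  let J' : Fin (b + 1) → Fin (d + 1) := fun k => ⟨J k, Nat.lt_succ_iff.2 (hJ k)⟩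
  have hdet' : (Matrix.of fun k i => coeffMatrix G i (J' k)).det ≠ 0 := by
    intro h0
    apply hdet
    have h1 : (Matrix.of fun i k => substVec d (fun a c =>
        algebraMap R (LocalRing x) (X (a, c)))
        (fun i => dehom ℂ (G i).1) (J k) i) = (algebraMap R
        (LocalRing x)).mapMatrix
          (Matrix.of fun k i => coeffMatrix G i (J' k)).transpose := by
      ext i k
      exact hφ (J' k) i
    rw [h1, ← RingHom.map_det, Matrix.det_transpose, h0, map_zero]
  obtain ⟨a, h, r, hh, hhx, hr, hrel⟩ := exists_homogeneous_relation G x (J := J') fun j => by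
    have := hspan j (Nat.lt_succ_iff.1 j.2)
    rw [show substVec d _ _ j = _ from funext (hφ j)] at this
    have hr : (fun k => substVec d (fun a c => algebraMap R (LocalRing x) (X (a, c)))
        (fun i => dehom ℂ (G i).1) (J k)) =
        fun k i => algebraMap R (LocalRing x) (coeffMatrix G i (J' k)) :=
      funext fun k => funext (hφ (J' k))
    rwa [hr] at this
  refine ⟨Fin (b + 1), inferInstance, fun k => column G (J' k), a, h, ?_,
    fun k => column_mem G (J' k), hh, hhx, fun e n hn => ?_⟩
  · apply LinearIndependent.of_comp (columnModule G).subtype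
    exact Matrix.linearIndependent_rows_of_det_ne_zero hdet'
  · obtain ⟨p, hp, hpn⟩ := exists_homogeneous_combination G hn
    -- Write n as ∑ p_j times column j with p_j of degree e, and replace h times column j by its
    -- expression in the chosen columns.
    refine ⟨fun k => ∑ j, r j k * p j, fun k => sum_mem fun j _ =>
      SetLike.mul_mem_graded (hr j k) (hp j), Subtype.ext (funext fun i => ?_)⟩
    have h1 : ((∑ k, (∑ j, r j k * p j) • column G (J' k) : columnModule G)).1 i =
        ∑ k, (∑ j, r j k * p j) * coeffMatrix G i (J' k) := by
      simp [column]
    rw [h1]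
    change h * n.1 i = _
    rw [hpn, Finset.mul_sum]
    simp only [Finset.sum_mul]
    rw [Finset.sum_comm]
    refine Finset.sum_congr rfl fun j _ => ?_
    rw [mul_left_comm, hrel, Finset.mul_sum]
    exact Finset.sum_congr rfl fun k _ => by ring

end BinaryForm

/-! ### Lines in projective three-space and their equations -/

namespace BinaryForm

theorem exists_rep_ne_zero (p : ℙ ℂ (Fin 2 → ℂ)) : ∃ i, p.rep i ≠ 0 := by
  by_contra! h
  exact p.rep_nonzero (funext h)

theorem vecMulVec_ne_zero (p : ℙ ℂ (Fin 2 → ℂ)) {u : Fin 2 → ℂ} (hu : u ≠ 0) :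
    Matrix.vecMulVec p.rep u ≠ 0 := by
  obtain ⟨i, hi⟩ := exists_rep_ne_zero p
  intro h
  apply hu
  funext k
  have := congrFun (congrFun h i) k
  simpa [Matrix.vecMulVec_apply, hi] using this

theorem isLine_line (p : ℙ ℂ (Fin 2 → ℂ)) : IsLine (line p) := by
  let f : (Fin 2 → ℂ) →ₗ[ℂ] Matrix (Fin 2) (Fin 2) ℂ :=
    { toFun := fun u => Matrix.vecMulVec p.rep u
      map_add' := Matrix.vecMulVec_add _
      map_smul' := fun c u => Matrix.vecMulVec_smul _ _ _ }
  have hf : Function.Injective f := by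
    rw [injective_iff_map_eq_zero]
    intro u hu
    by_contra h
    exact vecMulVec_ne_zero p h hu
  refine ⟨LinearMap.range f, ?_, ?_⟩
  · rw [LinearMap.finrank_range_of_inj hf]
    simp
  · ext A
    rw [Set.mem_ofPred_eq, Projectivization.submodule_eq, Submodule.span_singleton_le_iff_mem]
    exact ⟨fun ⟨u, hu⟩ => ⟨u, hu.symm⟩, fun ⟨u, hu⟩ => ⟨u, hu.symm⟩⟩

/-- The two linear equations of `line p`. -/
def lineForm (p : ℙ ℂ (Fin 2 → ℂ)) (k : Fin 2) : R :=
  C (p.rep 1) * X (0, k) - C (p.rep 0) * X (1, k)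

theorem toLine_lineForm {p : ℙ ℂ (Fin 2 → ℂ)} {A : ℙ ℂ (Matrix (Fin 2) (Fin 2) ℂ)}
    (hA : A ∈ line p) (k : Fin 2) : toLine A.rep (lineForm p k) = 0 := by
  obtain ⟨u, hu⟩ := hA
  simp [toLine, lineForm, hu, Matrix.vecMulVec_apply]
  ring

theorem eval_toLine (A : Matrix (Fin 2) (Fin 2) ℂ) (f : R) (c : ℂ) :
    (toLine A f).eval c = eval (fun ij => c * A ij.1 ij.2) f := by
  have : (Polynomial.aeval c).comp (toLine A) = aeval (fun ij => c * A ij.1 ij.2) := by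
    apply algHom_ext
    intro ij
    simp only [AlgHom.comp_apply, toLine, aeval_X, map_mul, Polynomial.aeval_C, Polynomial.aeval_X]
    exact mul_comm _ _
  exact (DFunLike.congr_fun this f).trans (RingHom.congr_fun (coe_aeval_eq_eval _) f)

/-- Points of the line enter through chosen representatives, which are determined only up to
scaling; `toLine` sees the whole ray, so the polynomial vanishes on the cone over the line. -/
theorem eval_vecMulVec_eq_zero {p : ℙ ℂ (Fin 2 → ℂ)} {f : R}
    (hf : ∀ A ∈ line p, toLine A.rep f = 0) (u : Fin 2 → ℂ) :
    eval (fun ij : Fin 2 × Fin 2 => p.rep ij.1 * u ij.2) f = 0 := by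
  have key : ∀ u : Fin 2 → ℂ, u ≠ 0 → ∀ c : ℂ,
      eval (fun ij : Fin 2 × Fin 2 => c * (p.rep ij.1 * u ij.2)) f = 0 := by
    intro u hu c
    let A := Projectivization.mk ℂ _ (vecMulVec_ne_zero p hu)
    obtain ⟨a, ha⟩ := Projectivization.exists_smul_eq_mk_rep ℂ _ (vecMulVec_ne_zero p hu)
    have hA : A ∈ line p := ⟨(a : ℂ) • u, by rw [Matrix.vecMulVec_smul]; exact ha.symm⟩
    -- The factor a⁻¹ compensates for the representative being a times the matrix at hand.
    have h := eval_toLine A.rep f (c * (a : ℂ)⁻¹)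
    rw [hf A hA, Polynomial.eval_zero] at h
    rw [h]
    congr 2
    funext ij
    have h2 : A.rep ij.1 ij.2 = a * (p.rep ij.1 * u ij.2) :=
      (congrFun (congrFun ha ij.1) ij.2).symm
    rw [h2]
    field_simp
  rcases eq_or_ne u 0 with rfl | hu
  · have := key (fun _ => 1) (fun h => one_ne_zero (congrFun h 0)) 0
    simpa using this
  · simpa using key u hu 1

/-- The two linear forms cut out the line. Conversely, if f vanishes on the line, then `φ`, which
restricts f to the parametrization u ↦ (p_i u_k), kills f; modulo the two forms `ψ` inverts `φ`, so
f is in every homogeneous prime containing them. -/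
theorem mem_closedLine_iff (p : ℙ ℂ (Fin 2 → ℂ)) (x : ProjectiveSpectrum grading) :
    (show P3 from x) ∈ closedLine p ↔ ∀ k, lineForm p k ∈ x.asHomogeneousIdeal.toIdeal := by
  have hcl : closedLine p = ProjectiveSpectrum.zeroLocus grading
      (ProjectiveSpectrum.vanishingIdeal (closedPoint '' line p)) :=
    (ProjectiveSpectrum.zeroLocus_vanishingIdeal_eq_closure grading _).symm
  rw [hcl]
  constructor
  · intro h k
    refine h ((ProjectiveSpectrum.mem_vanishingIdeal _ _).2 ?_)
    rintro _ ⟨A, hA, rfl⟩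
    exact toLine_lineForm hA k
  · intro h f hf
    have hf' : ∀ A ∈ line p, toLine A.rep f = 0 := fun A hA =>
      (ProjectiveSpectrum.mem_vanishingIdeal _ _).1 hf (closedPoint A) ⟨A, hA, rfl⟩
    let φ : R →ₐ[ℂ] MvPolynomial (Fin 2) ℂ := aeval fun ij => C (p.rep ij.1) * X ij.2
    have hφ : φ f = 0 := by
      apply MvPolynomial.funext
      intro u
      rw [map_zero, ← eval_vecMulVec_eq_zero hf' u]
      have : (aeval u).comp φ = aeval fun ij : Fin 2 × Fin 2 => p.rep ij.1 * u ij.2 := by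
        apply algHom_ext
        intro ij
        simp [φ]
      exact (RingHom.congr_fun (coe_aeval_eq_eval u) (φ f)).symm.trans
        ((DFunLike.congr_fun this f).trans (RingHom.congr_fun (coe_aeval_eq_eval _) f))
    obtain ⟨i, hi⟩ := exists_rep_ne_zero p
    let ψ : MvPolynomial (Fin 2) ℂ →ₐ[ℂ] R := aeval fun k => C (p.rep i)⁻¹ * X (i, k)
    have hψ : ((Ideal.Quotient.mkₐ ℂ x.asHomogeneousIdeal.toIdeal).comp (ψ.comp φ)) =
        Ideal.Quotient.mkₐ ℂ x.asHomogeneousIdeal.toIdeal := by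
      apply algHom_ext
      rintro ⟨a, k⟩
      have h1 : ψ (φ (X (a, k))) = C (p.rep a * (p.rep i)⁻¹) * X (i, k) := by
        simp [φ, ψ, mul_assoc]
      rw [AlgHom.comp_apply, AlgHom.comp_apply, h1, Ideal.Quotient.mkₐ_eq_mk, Ideal.Quotient.eq]
      have h2 : ∀ e : R, e ∈ x.asHomogeneousIdeal.toIdeal → ∀ c : ℂ,
        C c * e ∈ x.asHomogeneousIdeal.toIdeal := fun e he c => Ideal.mul_mem_left _ _ he
      have hc : (C (p.rep i) * C (p.rep i)⁻¹ : R) = 1 := by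
        rw [← C_mul, mul_inv_cancel₀ hi, C_1]
      fin_cases i <;> fin_cases a
      · convert Ideal.zero_mem x.asHomogeneousIdeal.toIdeal using 1
        simp only [Fin.zero_eta, C_mul] at hc ⊢
        rw [hc]; ring
      · convert h2 _ (h k) (p.rep 0)⁻¹ using 1
        simp only [Fin.zero_eta, Fin.mk_one, C_mul, lineForm] at hc ⊢
        linear_combination X (1, k) * hc
      · convert h2 _ (h k) (-(p.rep 1)⁻¹) using 1
        simp only [Fin.zero_eta, Fin.mk_one, C_mul, lineForm, C_neg] at hc ⊢
        linear_combination X (0, k) * hc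
      · convert Ideal.zero_mem x.asHomogeneousIdeal.toIdeal using 1
        simp only [Fin.mk_one, C_mul] at hc ⊢
        rw [hc]; ring
    have h3 := DFunLike.congr_fun hψ f
    rw [AlgHom.comp_apply, AlgHom.comp_apply, hφ, map_zero, map_zero] at h3
    exact Ideal.Quotient.eq_zero_iff_mem.1 h3.symm

theorem exists_X_notMem (x : ProjectiveSpectrum grading) :
    ∃ i k, (X (i, k) : R) ∉ x.asHomogeneousIdeal.toIdeal := by
  by_contra! h
  apply x.not_irrelevant_le
  intro f hf
  rw [HomogeneousIdeal.mem_irrelevant_iff] at hf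
  have hf0 : homogeneousComponent 0 f = 0 :=
    (decomposition.decompose'_apply f 0).symm.trans hf
  rw [homogeneousComponent_zero, C_eq_zero] at hf0
  have : Ideal.Quotient.mkₐ ℂ x.asHomogeneousIdeal.toIdeal =
      (Algebra.ofId ℂ _).comp (aeval fun _ => (0 : ℂ)) := by
    apply algHom_ext
    intro ij
    simpa using Ideal.Quotient.eq_zero_iff_mem.2 (h ij.1 ij.2)
  have h1 := DFunLike.congr_fun this f
  have h2 : aeval (fun _ => (0 : ℂ)) f = (0 : ℂ) := by
    have := aeval_zero (S₁ := ℂ) f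
    rw [constantCoeff_eq, hf0] at this
    simpa using this
  rw [AlgHom.comp_apply, h2, map_zero] at h1
  exact Ideal.Quotient.eq_zero_iff_mem.1 h1

/-- On the line the rows of the matrix are proportional: each p_i times the determinant is a
combination of the two linear forms. -/
theorem det_mem_of_mem_closedLine {p : ℙ ℂ (Fin 2 → ℂ)} {x : ProjectiveSpectrum grading}
    (h : (show P3 from x) ∈ closedLine p) :
    (X (0, 0) * X (1, 1) - X (0, 1) * X (1, 0) : R) ∈ x.asHomogeneousIdeal.toIdeal := by
  rw [mem_closedLine_iff] at h
  obtain ⟨i, hi⟩ := exists_rep_ne_zero p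
  have hu : IsUnit (C (p.rep i) : R) := (IsUnit.mk0 _ hi).map C
  rw [← Ideal.unit_mul_mem_iff_mem _ hu]
  fin_cases i
  · have : C (p.rep 0) * (X (0, 0) * X (1, 1) - X (0, 1) * X (1, 0) : R) =
        X (0, 1) * lineForm p 0 - X (0, 0) * lineForm p 1 := by
      simp only [lineForm]; ring
    simp only [Fin.zero_eta, this]
    exact sub_mem (Ideal.mul_mem_left _ _ (h 0)) (Ideal.mul_mem_left _ _ (h 1))
  · have : C (p.rep 1) * (X (0, 0) * X (1, 1) - X (0, 1) * X (1, 0) : R) =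
        X (1, 1) * lineForm p 0 - X (1, 0) * lineForm p 1 := by
      simp only [lineForm]; ring
    simp only [Fin.mk_one, this]
    exact sub_mem (Ideal.mul_mem_left _ _ (h 0)) (Ideal.mul_mem_left _ _ (h 1))

theorem det_rep_ne_zero {p q : ℙ ℂ (Fin 2 → ℂ)} (h : p ≠ q) :
    p.rep 0 * q.rep 1 - p.rep 1 * q.rep 0 ≠ 0 := by
  intro h0
  apply h
  obtain ⟨i, hi⟩ := exists_rep_ne_zero q
  rw [← p.mk_rep, ← q.mk_rep, Projectivization.mk_eq_mk_iff']
  refine ⟨p.rep i / q.rep i, ?_⟩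
  funext k
  simp only [Pi.smul_apply, smul_eq_mul]
  rw [div_mul_eq_mul_div, div_eq_iff hi]
  fin_cases i <;> fin_cases k <;> simp only [Fin.zero_eta, Fin.mk_one] <;>
    first | linear_combination h0 | linear_combination -h0

/-- For p ≠ q the number p_0 q_1 − p_1 q_0 is invertible, and its product with each coordinate is a
combination of the forms of both lines. A common point would have all coordinates in its prime. -/
theorem disjoint_closedLine {p q : ℙ ℂ (Fin 2 → ℂ)} (h : p ≠ q) :
    Disjoint (closedLine p) (closedLine q) := by
  rw [Set.disjoint_left]
  intro (x : ProjectiveSpectrum grading) hp hq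
  have hp' := (mem_closedLine_iff p x).1 hp
  have hq' := (mem_closedLine_iff q x).1 hq
  obtain ⟨i, k, hik⟩ := exists_X_notMem x
  apply hik
  have hu : IsUnit (C (p.rep 0 * q.rep 1 - p.rep 1 * q.rep 0) : R) :=
    (IsUnit.mk0 _ (det_rep_ne_zero h)).map C
  rw [← Ideal.unit_mul_mem_iff_mem _ hu]
  have : C (p.rep 0 * q.rep 1 - p.rep 1 * q.rep 0) * (X (i, k) : R) =
      C (p.rep i) * lineForm q k - C (q.rep i) * lineForm p k := by
    simp only [lineForm, C_sub, C_mul]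
    fin_cases i <;> simp only [Fin.zero_eta, Fin.mk_one] <;> ring
  rw [this]
  exact sub_mem (Ideal.mul_mem_left _ _ (hq' k)) (Ideal.mul_mem_left _ _ (hp' k))

end BinaryForm

/-! ### The degree of the Wronskian -/

namespace BinaryForm

variable {b d : ℕ}

/-- The coefficient of `s ^ (b - j) * t ^ j` in the `b`-th polar of a form of degree `d`, up to a
constant and in an affine coordinate. -/
def polar (b d : ℕ) (g : Polynomial ℂ) (j : ℕ) : Polynomial ℂ :=
  ∑ m ∈ Finset.range (d + 1),
    Polynomial.monomial (m - j) (g.coeff m * ((d - m).choose (b - j) * m.choose j : ℕ))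

/-- Rewriting C(j,k)·C(m,j) as C(m,k)·C(m−k,j−k) reduces this to Vandermonde's identity. -/
theorem sum_choose_mul_choose (hbd : b ≤ d) {k m : ℕ} (hk : k ≤ b) (hm : m ≤ d) :
    ∑ j ∈ Finset.range (b + 1), j.choose k * ((d - m).choose (b - j) * m.choose j) =
      (d - k).choose (b - k) * m.choose k := by
  rcases lt_or_ge m k with h | h
  · rw [Nat.choose_eq_zero_of_lt h, mul_zero]
    refine Finset.sum_eq_zero fun j _ => ?_
    rcases lt_or_ge j k with h1 | h1
    · rw [Nat.choose_eq_zero_of_lt h1, zero_mul]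
    · rw [Nat.choose_eq_zero_of_lt (h.trans_le h1), mul_zero, mul_zero]
  · have h2 : d - k = (m - k) + (d - m) := by omega
    rw [h2, Nat.add_choose_eq, Finset.Nat.sum_antidiagonal_eq_sum_range_succ_mk, Finset.sum_mul,
      ← Finset.sum_range_add_sum_Ico _ (show k ≤ b + 1 by omega),
      Finset.sum_eq_zero (s := Finset.range k), zero_add, Finset.sum_Ico_eq_sum_range]
    · rw [show b + 1 - k = (b - k).succ by omega]
      refine Finset.sum_congr rfl fun i hi => ?_
      have hi : i ≤ b - k := Nat.lt_succ_iff.1 (Finset.mem_range.1 hi)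
      rw [show b - (k + i) = b - k - i by omega]
      rcases lt_or_ge m (k + i) with h3 | h3
      · rw [Nat.choose_eq_zero_of_lt h3, Nat.choose_eq_zero_of_lt (show m - k < i by omega)]
        simp
      · have := Nat.choose_mul (n := m) (Nat.le_add_right k i)
        rw [Nat.add_sub_cancel_left] at this
        calc _ = m.choose (k + i) * (k + i).choose k * (d - m).choose (b - k - i) := by ring
          _ = _ := by rw [this]; ring
    · intro j hj
      rw [Nat.choose_eq_zero_of_lt (Finset.mem_range.1 hj), zero_mul]

/-- An Euler relation: a Hasse derivative of order at most b is, up to a constant, a combination of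
polars whose coefficients form a unitriangular matrix. -/
theorem sum_choose_mul_polar (hbd : b ≤ d) {g : Polynomial ℂ} (hg : g.natDegree ≤ d) {k : ℕ}
    (hk : k ≤ b) :
    ∑ j ∈ Finset.range (b + 1),
        polar b d g j * Polynomial.monomial (j - k) ((j.choose k : ℕ) : ℂ) =
      Polynomial.C (((d - k).choose (b - k) : ℕ) : ℂ) * Polynomial.hasseDeriv k g := by
  simp only [polar, Finset.sum_mul, Polynomial.monomial_mul_monomial]
  rw [Finset.sum_comm]
  conv_rhs => rw [g.as_sum_range' (d + 1) (Nat.lt_succ_iff.2 hg), map_sum, Finset.mul_sum]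
  refine Finset.sum_congr rfl fun m hm => ?_
  have hm : m ≤ d := Nat.lt_succ_iff.1 (Finset.mem_range.1 hm)
  rw [Polynomial.hasseDeriv_monomial, Polynomial.C_mul_monomial]
  have : ∀ j ∈ Finset.range (b + 1), Polynomial.monomial (m - j + (j - k))
      (g.coeff m * ((d - m).choose (b - j) * m.choose j : ℕ) * (j.choose k : ℕ)) =
      Polynomial.monomial (m - k)
        (g.coeff m * ((j.choose k * ((d - m).choose (b - j) * m.choose j) : ℕ) : ℂ)) := by
    intro j _
    rcases lt_or_ge j k with h1 | h1
    · simp [Nat.choose_eq_zero_of_lt h1]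
    rcases lt_or_ge m j with h2 | h2
    · simp [Nat.choose_eq_zero_of_lt h2]
    rw [show m - j + (j - k) = m - k by omega]
    congr 1
    push_cast
    ring
  rw [Finset.sum_congr rfl this, ← map_sum, ← Finset.mul_sum, ← Nat.cast_sum,
    sum_choose_mul_choose hbd hk hm]
  congr 1
  push_cast
  ring

theorem natDegree_polar_le (hbd : b ≤ d) (g : Polynomial ℂ) {j : ℕ} (hj : j ≤ b) :
    (polar b d g j).natDegree ≤ d - b := by
  refine Polynomial.natDegree_sum_le_of_forall_le _ _ fun m hm => ?_
  have hm : m ≤ d := Nat.lt_succ_iff.1 (Finset.mem_range.1 hm)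
  rcases lt_or_ge (d - m) (b - j) with h | h
  · simp [Nat.choose_eq_zero_of_lt h]
  · exact (Polynomial.natDegree_monomial_le _).trans (by omega)

theorem coeff_polar (hbd : b ≤ d) (g : Polynomial ℂ) {j : ℕ} (hj : j ≤ b) :
    (polar b d g j).coeff (d - b) = g.coeff (d - b + j) * ((d - b + j).choose j : ℕ) := by
  rw [polar, Polynomial.finsetSum_coeff, Finset.sum_eq_single (d - b + j)]
  · rw [Nat.add_sub_cancel, Polynomial.coeff_monomial, if_pos rfl,
      show d - (d - b + j) = b - j by omega, Nat.choose_self, one_mul]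
  · intro m hm hmj
    rw [Polynomial.coeff_monomial]
    split_ifs with h
    -- The exponents can agree here only through truncated subtraction, and then the binomial
    -- coefficient vanishes.
    · rw [Nat.choose_eq_zero_of_lt (show m < j by omega)]
      simp
    · rfl
  · intro h
    simp at h
    omega

section
variable {g : Fin (b + 1) → Polynomial ℂ}

/-- Column operations replace the derivatives by polars. The degrees of the derivatives alone bound
the degree of the Wronskian too weakly; polars have degree at most d − b and give the sharp bound.
-/
theorem C_mul_wronskian (hbd : b ≤ d) (hg : ∀ i, (g i).natDegree ≤ d) :
    Polynomial.C (∏ k : Fin (b + 1), (((d - k).choose (b - k) : ℕ) : ℂ)) * wronskian g =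
      (Matrix.of fun i j : Fin (b + 1) => polar b d (g i) j).det := by
  let T : Matrix (Fin (b + 1)) (Fin (b + 1)) (Polynomial ℂ) := Matrix.of fun j k =>
    Polynomial.monomial ((j : ℕ) - k) (((j : ℕ).choose k : ℕ) : ℂ)
  have hT : T.det = 1 := by
    rw [Matrix.det_of_isLowerTriangular T]
    · refine Finset.prod_eq_one fun i _ => ?_
      simp [T]
    · intro i j hij
      have : (i : ℕ) < j := hij
      simp [T, Nat.choose_eq_zero_of_lt this]
  rw [← mul_one (Matrix.det _), ← hT, ← Matrix.det_mul, wronskian, map_prod, ← Matrix.det_mul_row]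
  congr 1
  ext1 i k
  have := sum_choose_mul_polar hbd (hg i) (Nat.lt_succ_iff.1 k.2)
  rw [Matrix.of_apply, Matrix.of_apply, Matrix.mul_apply, ← this, Finset.sum_range]
  rfl

theorem coeff_det_of_natDegree_le {n e : ℕ} (M : Matrix (Fin n) (Fin n) (Polynomial ℂ))
    (h : ∀ i j, (M i j).natDegree ≤ e) :
    M.det.natDegree ≤ n * e ∧ M.det.coeff (n * e) = (Matrix.of fun i j => (M i j).coeff e).det := by
  simp only [Matrix.det_apply]
  constructor
  · refine Polynomial.natDegree_sum_le_of_forall_le _ _ fun σ _ => ?_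
    refine (Polynomial.natDegree_smul_le _ _).trans ((Polynomial.natDegree_prod_le _ _).trans ?_)
    refine (Finset.sum_le_card_nsmul _ _ e fun i _ => h _ _).trans ?_
    simp
  · rw [Polynomial.finsetSum_coeff]
    refine Finset.sum_congr rfl fun σ _ => ?_
    rw [Polynomial.coeff_smul]
    have := Polynomial.coeff_prod_of_natDegree_le (s := Finset.univ) (fun i => M (σ i) i) e
      fun i _ => h _ _
    rw [Finset.card_univ, Fintype.card_fin] at this
    rw [this]
    rfl

theorem prod_choose_ne_zero (hbd : b ≤ d) :
    (∏ k : Fin (b + 1), (((d - k).choose (b - k) : ℕ) : ℂ)) ≠ 0 :=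
  Finset.prod_ne_zero_iff.2 fun k _ => Nat.cast_ne_zero.2
    (Nat.choose_pos (by omega)).ne'

theorem natDegree_wronskian_le (hbd : b ≤ d) (hg : ∀ i, (g i).natDegree ≤ d) :
    (wronskian g).natDegree ≤ (b + 1) * (d - b) := by
  rw [← Polynomial.natDegree_C_mul (prod_choose_ne_zero hbd), C_mul_wronskian hbd hg]
  exact (coeff_det_of_natDegree_le _ fun i j =>
    natDegree_polar_le hbd (g i) (Nat.lt_succ_iff.1 j.2)).1

/-- The coefficients of degree d − b of the polars are the top b + 1 coefficients of the forms, in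
reverse order and scaled by nonzero binomials. Their determinant is a nonzero multiple of
`topMinor`. -/
theorem coeff_wronskian_ne_zero_iff (hbd : b ≤ d) (hg : ∀ i, (g i).natDegree ≤ d) :
    (wronskian g).coeff ((b + 1) * (d - b)) ≠ 0 ↔ topMinor g d ≠ 0 := by
  have h1 : (Matrix.of fun i j : Fin (b + 1) => (polar b d (g i) j).coeff (d - b)).det =
      (∏ j : Fin (b + 1), (((d - b + j).choose j : ℕ) : ℂ)) *
        ((Equiv.Perm.sign (Fin.revPerm : Equiv.Perm (Fin (b + 1))) : ℤ) * topMinor g d) := by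
    rw [topMinor, ← Matrix.det_permute', ← Matrix.det_mul_row]
    congr 1
    ext1 i j
    rw [Matrix.of_apply, Matrix.of_apply, coeff_polar hbd _ (Nat.lt_succ_iff.1 j.2), mul_comm]
    simp only [Matrix.submatrix_apply, Matrix.of_apply, id, Fin.revPerm_apply, Fin.val_rev]
    congr 3
    omega
  have h2 := (coeff_det_of_natDegree_le (Matrix.of fun i j : Fin (b + 1) => polar b d (g i) j)
    fun i j => natDegree_polar_le hbd (g i) (Nat.lt_succ_iff.1 j.2)).2
  rw [← C_mul_wronskian hbd hg, Polynomial.coeff_C_mul] at h2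
  simp only [Matrix.of_apply] at h2
  rw [h1] at h2
  have h3 : (∏ j : Fin (b + 1), (((d - b + j).choose j : ℕ) : ℂ)) ≠ 0 :=
    Finset.prod_ne_zero_iff.2 fun k _ => Nat.cast_ne_zero.2 (Nat.choose_pos (by omega)).ne'
  have h4 : ((Equiv.Perm.sign (Fin.revPerm : Equiv.Perm (Fin (b + 1))) : ℤ) : ℂ) ≠ 0 := by
    simp
  constructor
  · intro h h0
    rw [h0, mul_zero, mul_zero] at h2
    exact mul_ne_zero (prod_choose_ne_zero hbd) h h2
  · intro h h0
    rw [h0, mul_zero] at h2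
    exact mul_ne_zero h3 (mul_ne_zero h4 h) h2.symm

theorem natDegree_wronskian (hbd : b ≤ d) (hg : ∀ i, (g i).natDegree ≤ d)
    (htop : topMinor g d ≠ 0) : (wronskian g).natDegree = (b + 1) * (d - b) :=
  (natDegree_wronskian_le hbd hg).antisymm
    (Polynomial.le_natDegree_of_ne_zero ((coeff_wronskian_ne_zero_iff hbd hg).2 htop))

theorem wronskian_ne_zero (hbd : b ≤ d) (hg : ∀ i, (g i).natDegree ≤ d)
    (htop : topMinor g d ≠ 0) : wronskian g ≠ 0 := fun h =>
  (coeff_wronskian_ne_zero_iff hbd hg).2 htop (by rw [h, Polynomial.coeff_zero])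

end

end BinaryForm

/-! ### Bad points as roots of the Wronskian -/

theorem Module.Basis.exists_mem_ne_zero_iff_det {E : Type*} [AddCommGroup E] [Module ℂ E]
    {V : Submodule ℂ E} {n : ℕ} (G : Module.Basis (Fin n) ℂ V) (Λ : E →ₗ[ℂ] (Fin n → ℂ)) :
    (∃ F ∈ V, F ≠ 0 ∧ Λ F = 0) ↔ (Matrix.of fun i k => Λ (G i).1 k).det = 0 := by
  have key : ∀ c : Fin n → ℂ, Λ (G.equivFun.symm c).1 =
      Matrix.vecMul c (Matrix.of fun i k => Λ (G i).1 k) := by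
    intro c
    rw [Module.Basis.equivFun_symm_apply, AddSubmonoidClass.coe_finsetSum, map_sum]
    ext k
    simp [Matrix.vecMul, dotProduct]
  rw [← Matrix.exists_vecMul_eq_zero_iff]
  constructor
  · rintro ⟨F, hF, h0, h⟩
    refine ⟨G.equivFun ⟨F, hF⟩, ?_, ?_⟩
    · intro h1
      apply h0
      have := (LinearEquiv.map_eq_zero_iff _).1 h1
      exact congrArg Subtype.val this
    · rw [← key, LinearEquiv.symm_apply_apply, h]
  · rintro ⟨c, hc, h⟩
    refine ⟨_, (G.equivFun.symm c).2, ?_, ?_⟩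
    · intro h1
      exact hc ((LinearEquiv.map_eq_zero_iff G.equivFun.symm).1 (Subtype.ext h1))
    · rw [key, h]

namespace BinaryForm

variable {b d : ℕ}

theorem hasseDeriv_map {S T : Type*} [CommRing S] [CommRing T] (φ : S →+* T) (k : ℕ)
    (p : Polynomial S) :
    Polynomial.hasseDeriv k (p.map φ) = (Polynomial.hasseDeriv k p).map φ := by
  ext n
  simp [Polynomial.hasseDeriv_coeff]

theorem wronskian_map {S T : Type*} [CommRing S] [CommRing T] (φ : S →+* T)
    (g : Fin (b + 1) → Polynomial S) :
    wronskian (fun i => (g i).map φ) = (wronskian g).map φ := by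
  rw [wronskian, wronskian, ← Polynomial.coe_mapRingHom, RingHom.map_det]
  congr 1
  ext1 i k
  exact hasseDeriv_map φ _ _

theorem topMinor_map {S T : Type*} [CommRing S] [CommRing T] (φ : S →+* T)
    (g : Fin (b + 1) → Polynomial S) :
    topMinor (fun i => (g i).map φ) d = φ (topMinor g d) := by
  rw [topMinor, topMinor, RingHom.map_det]
  congr 1
  ext1 i k
  simp

/-- For the converse, substitute t = (y/x)s − x⁻¹(ys − xt) and expand homogeneously around y/x: the
k-th term contains the k-th power of the linear form. -/
theorem linearForm_pow_dvd_iff {F : MvPolynomial (Fin 2) ℂ} (hF : F.IsHomogeneous d) {x y : ℂ}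
    (hx : x ≠ 0) (n : ℕ) :
    (C y * X 0 - C x * X 1) ^ n ∣ F ↔
      ∀ k < n, (Polynomial.hasseDeriv k (dehom ℂ F)).eval (y / x) = 0 := by
  constructor
  · intro h
    have h1 := map_dvd (dehom ℂ) h
    have h2 : dehom ℂ (C y * X 0 - C x * X 1) =
        Polynomial.C (-x) * (Polynomial.X - Polynomial.C (y / x)) := by
      have : Polynomial.C y = Polynomial.C x * Polynomial.C (y / x) := by
        rw [← Polynomial.C_mul, mul_div_cancel₀ _ hx]
      simp only [dehom, map_sub, map_mul, aeval_X, algHom_C, Polynomial.algebraMap_apply,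
        Algebra.algebraMap_self_apply, Matrix.cons_val_zero, Matrix.cons_val_one, Polynomial.C_neg]
      rw [this]
      ring
    rw [map_pow, h2, mul_pow] at h1
    have h3 := (dvd_mul_left _ _).trans h1
    rw [Polynomial.X_sub_C_pow_dvd_iff, Polynomial.X_pow_dvd_iff] at h3
    intro k hk
    rw [← Polynomial.taylor_coeff]
    exact h3 k hk
  · intro h
    have h1 : aeval (X : Fin 2 → MvPolynomial (Fin 2) ℂ) F = F := aeval_X_left_apply F
    have h2 : (X 1 : MvPolynomial (Fin 2) ℂ) = algebraMap ℂ _ (y / x) * X 0 +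
        -C x⁻¹ * (C y * X 0 - C x * X 1) := by
      have e1 : (C x⁻¹ * C x : MvPolynomial (Fin 2) ℂ) = 1 := by
        rw [← C_mul, inv_mul_cancel₀ hx, C_1]
      rw [algebraMap_eq, div_eq_mul_inv, C_mul]
      linear_combination -X 1 * e1
    rw [aeval_eq_homEval hF] at h1
    refine Dvd.dvd.trans ?_ (dvd_of_eq h1)
    generalize (C y * X 0 - C x * X 1 : MvPolynomial (Fin 2) ℂ) = E at h2 ⊢
    rw [h2, homEval_taylor (natDegree_dehom_le hF)]
    refine Finset.dvd_sum fun k _ => ?_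
    rcases lt_or_ge k n with hk | hk
    · rw [Polynomial.aeval_algebraMap_apply, Polynomial.coe_aeval_eq_eval, h k hk]
      simp
    · rw [mul_pow]
      exact ((pow_dvd_pow _ hk).mul_left _).mul_left _

theorem X_pow_dvd_iff_coeff_dehom {F : MvPolynomial (Fin 2) ℂ} (hF : F.IsHomogeneous d) {n : ℕ}
    (hn : n ≤ d + 1) :
    (X 0 : MvPolynomial (Fin 2) ℂ) ^ n ∣ F ↔ ∀ k < n, (dehom ℂ F).coeff (d - k) = 0 := by
  constructor
  · rintro ⟨Q, rfl⟩ k hk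
    rw [coeff_dehom hF (Nat.sub_le _ _), X_pow_eq_monomial, coeff_monomial_mul', if_neg]
    intro h
    have := h 0
    simp [mono] at this
    omega
  · intro h
    rw [eq_sum_monomial hF]
    refine Finset.dvd_sum fun m hm => ?_
    have hm : m ≤ d := Nat.lt_succ_iff.1 (Finset.mem_range.1 hm)
    rcases lt_or_ge (d - m) n with hk | hk
    · have := h _ hk
      rw [Nat.sub_sub_self hm, coeff_dehom hF hm] at this
      rw [this, map_zero]
      exact dvd_zero _
    · rw [X_pow_eq_monomial]
      refine (monomial_dvd_monomial).2 ⟨Or.inr ?_, one_dvd _⟩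
      intro i
      fin_cases i
      · simpa [mono] using hk
      · simp

/-- Dehomogenizations of the members of a basis. -/
abbrev dehomBasis {V : Submodule ℂ (Forms d)} (G : Module.Basis (Fin (b + 1)) ℂ V)
    (i : Fin (b + 1)) : Polynomial ℂ :=
  dehom ℂ (G i).1.1

/-- Vanishing to order b + 1 is the vanishing of b + 1 functionals, the Hasse derivatives at the
point; their matrix on a basis has the Wronskian's value as determinant. -/
theorem mem_badPoints_iff (V : Gr b d) (G : Module.Basis (Fin (b + 1)) ℂ V.1)
    {p : ℙ ℂ (Fin 2 → ℂ)} (hp : p.rep 0 ≠ 0) :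
    p ∈ badPoints V ↔ (wronskian (dehomBasis G)).IsRoot (p.rep 1 / p.rep 0) := by
  let Λ : Forms d →ₗ[ℂ] (Fin (b + 1) → ℂ) := LinearMap.pi fun k =>
    (Polynomial.leval (p.rep 1 / p.rep 0)) ∘ₗ (Polynomial.hasseDeriv k) ∘ₗ
      (dehom ℂ).toLinearMap ∘ₗ (homogeneousSubmodule (Fin 2) ℂ d).subtype
  have h := G.exists_mem_ne_zero_iff_det Λ
  rw [Polynomial.IsRoot.def, ← Polynomial.coe_aeval_eq_eval, aeval_wronskian]
  refine Iff.trans ?_ (h.trans ?_)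
  · refine exists_congr fun F => and_congr_right fun _ => and_congr_right fun _ => ?_
    rw [linearForm_pow_dvd_iff F.2 hp, _root_.funext_iff]
    exact ⟨fun h k => h k k.2, fun h k hk => h ⟨k, hk⟩⟩
  · rfl

theorem mem_badPoints_iff_topMinor (hbd : b ≤ d) (V : Gr b d)
    (G : Module.Basis (Fin (b + 1)) ℂ V.1)
    {p : ℙ ℂ (Fin 2 → ℂ)} (hp : p.rep 0 = 0) :
    p ∈ badPoints V ↔ topMinor (dehomBasis G) d = 0 := by
  let Λ : Forms d →ₗ[ℂ] (Fin (b + 1) → ℂ) := LinearMap.pi fun k =>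
    (Polynomial.lcoeff ℂ (d - k)) ∘ₗ (dehom ℂ).toLinearMap ∘ₗ (homogeneousSubmodule (Fin 2) ℂ d).subtype
  have h := G.exists_mem_ne_zero_iff_det Λ
  refine Iff.trans ?_ (h.trans ?_)
  · refine exists_congr fun F => and_congr_right fun _ => and_congr_right fun _ => ?_
    have h1 : p.rep 1 ≠ 0 := by
      obtain ⟨i, hi⟩ := exists_rep_ne_zero p
      fin_cases i
      exacts [absurd hp hi, hi]
    have hu : IsUnit (C (p.rep 1) ^ (b + 1) : MvPolynomial (Fin 2) ℂ) :=
      ((IsUnit.mk0 _ h1).map C).pow _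
    rw [hp, C_0, zero_mul, sub_zero, mul_pow, hu.mul_left_dvd,
      X_pow_dvd_iff_coeff_dehom F.2 (by omega), _root_.funext_iff]
    exact ⟨fun h k => h k k.2, fun h k hk => h ⟨k, hk⟩⟩
  · rfl

/-- The point `(1 : ρ)`. -/
def affinePoint (ρ : ℂ) : ℙ ℂ (Fin 2 → ℂ) :=
  Projectivization.mk ℂ ![1, ρ] fun h => one_ne_zero (congrFun h 0)

theorem affinePoint_rep (ρ : ℂ) :
    (affinePoint ρ).rep 0 ≠ 0 ∧ (affinePoint ρ).rep 1 = ρ * (affinePoint ρ).rep 0 := by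
  obtain ⟨a, ha⟩ := Projectivization.exists_smul_eq_mk_rep ℂ ![1, ρ]
    fun h => one_ne_zero (congrFun h 0)
  rw [affinePoint, ← ha]
  simp [Units.smul_def, mul_comm]

theorem affinePoint_injective : Function.Injective affinePoint := fun ρ σ h => by
  have h1 := affinePoint_rep ρ
  have h2 := affinePoint_rep σ
  rw [← h] at h2
  exact mul_right_cancel₀ h1.1 (h1.2.symm.trans h2.2)

theorem eq_affinePoint {p : ℙ ℂ (Fin 2 → ℂ)} (hp : p.rep 0 ≠ 0) :
    p = affinePoint (p.rep 1 / p.rep 0) := by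
  conv_lhs => rw [← p.mk_rep]
  rw [affinePoint, Projectivization.mk_eq_mk_iff']
  refine ⟨p.rep 0, ?_⟩
  ext i
  fin_cases i
  · simp
  · simp [mul_div_cancel₀ _ hp]

theorem affinePoint_mem_badPoints_iff (V : Gr b d) (G : Module.Basis (Fin (b + 1)) ℂ V.1) (ρ : ℂ) :
    affinePoint ρ ∈ badPoints V ↔ (wronskian (dehomBasis G)).IsRoot ρ := by
  obtain ⟨h1, h2⟩ := affinePoint_rep ρ
  rw [mem_badPoints_iff V G h1, h2, mul_div_cancel_right₀ _ h1]

end BinaryForm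

/-! ### Openness of the good subspaces -/

namespace Polynomial

theorem nodup_roots_iff_of_ne_zero {w : Polynomial ℂ} (hw : w ≠ 0) :
    w.roots.Nodup ↔ ∀ ρ, w.IsRoot ρ → ¬(derivative w).IsRoot ρ := by
  classical
  rw [Multiset.nodup_iff_count_le_one]
  refine forall_congr' fun ρ => ?_
  rw [count_roots, ← not_lt, one_lt_rootMultiplicity_iff_isRoot hw, not_and]

/-- The resultant is a power of the leading coefficient times the product of the values of w' at the
roots of w. -/
theorem nodup_roots_iff_resultant {w : Polynomial ℂ} (hw : w ≠ 0) :
    w.roots.Nodup ↔ resultant w (derivative w) w.natDegree (w.natDegree - 1) ≠ 0 := by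
  rw [resultant_eq_prod_eval _ _ _ (natDegree_derivative_le w) (IsAlgClosed.splits w),
    mul_ne_zero_iff_left (pow_ne_zero _ (leadingCoeff_ne_zero.2 hw)), ne_eq, Multiset.prod_eq_zero_iff]
  rw [nodup_roots_iff_of_ne_zero hw]
  simp [mem_roots hw]

theorem nodup_roots_iff_encard {w : Polynomial ℂ} (hw : w ≠ 0) :
    w.roots.Nodup ↔ {ρ | w.IsRoot ρ}.encard = w.natDegree := by
  classical
  have h : {ρ | w.IsRoot ρ} = (w.roots.toFinset : Set ℂ) := by
    ext ρ
    simp [mem_roots hw]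
  rw [h, Set.encard_coe_eq_coe_finsetCard, Nat.cast_inj,
    (IsAlgClosed.splits w).natDegree_eq_card_roots, Multiset.toFinset_card_eq_card_iff_nodup]

end Polynomial

namespace BinaryForm

variable {b d : ℕ}

/-- Dehomogenized forms with indeterminate coefficients. -/
def universalForm (b d : ℕ) (i : Fin (b + 1)) :
    Polynomial (MvPolynomial (Fin (b + 1) × Fin (d + 1)) ℂ) :=
  ∑ m : Fin (d + 1), Polynomial.monomial m (X (i, m))

theorem universalForm_map {V : Submodule ℂ (Forms d)} (G : Module.Basis (Fin (b + 1)) ℂ V)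
    (i : Fin (b + 1)) :
    (universalForm b d i).map (eval fun ij => coeff (mono d ij.2) (G ij.1).1.1) =
      dehomBasis G i := by
  rw [dehomBasis, dehom_eq_sum (G i).1.2, Finset.sum_range, universalForm, Polynomial.map_sum]
  simp

/-- A polynomial in the coefficients of a basis that does not vanish if and only if the Wronskian
of the basis has the maximal number of distinct roots. -/
def discriminant (b d : ℕ) : MvPolynomial (Fin (b + 1) × Fin (d + 1)) ℂ :=
  topMinor (universalForm b d) d *
    Polynomial.resultant (wronskian (universalForm b d))
      (Polynomial.derivative (wronskian (universalForm b d)))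
      ((b + 1) * (d - b)) ((b + 1) * (d - b) - 1)

/-- Taking the resultant with fixed formal degrees makes it commute with specialization, even when
the actual degrees drop. -/
theorem eval_discriminant {V : Submodule ℂ (Forms d)} (G : Module.Basis (Fin (b + 1)) ℂ V) :
    eval (fun ij => coeff (mono d ij.2) (G ij.1).1.1) (discriminant b d) =
      topMinor (dehomBasis G) d * Polynomial.resultant (wronskian (dehomBasis G))
        (Polynomial.derivative (wronskian (dehomBasis G)))
        ((b + 1) * (d - b)) ((b + 1) * (d - b) - 1) := by
  have h := funext (universalForm_map G)
  rw [discriminant, map_mul, ← topMinor_map, ← Polynomial.resultant_map_map,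
    ← Polynomial.derivative_map, ← wronskian_map, h]

/-- The subspaces for which the Wronskian has the maximal number of distinct roots, none of them
at infinity. -/
def goodSubspaces (b d : ℕ) : Set (Gr b d) :=
  {V | (∀ p ∈ badPoints V, p.rep 0 ≠ 0) ∧ (badPoints V).encard = ((b + 1) * (d - b) : ℕ)}

theorem rep_ne_zero_iff (hbd : b ≤ d) (V : Gr b d) (G : Module.Basis (Fin (b + 1)) ℂ V.1) :
    (∀ p ∈ badPoints V, p.rep 0 ≠ 0) ↔ topMinor (dehomBasis G) d ≠ 0 := by
  constructor
  · intro h h0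
    have h1 : (![0, 1] : Fin 2 → ℂ) ≠ 0 := fun h => one_ne_zero (congrFun h 1)
    obtain ⟨a, ha⟩ := Projectivization.exists_smul_eq_mk_rep ℂ ![0, 1] h1
    have h2 : (Projectivization.mk ℂ ![0, 1] h1).rep 0 = 0 := by
      rw [← ha]
      simp
    exact h _ ((mem_badPoints_iff_topMinor hbd V G h2).2 h0) h2
  · intro h p hp h0
    exact h ((mem_badPoints_iff_topMinor hbd V G h0).1 hp)

/-- With no bad point at infinity, the bad points are the roots of a Wronskian of degree exactly (b
+ 1)(d − b); reaching that number means that all roots are simple. -/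
theorem mem_goodSubspaces_iff (hbd : b ≤ d) (V : Gr b d)
    (G : Module.Basis (Fin (b + 1)) ℂ V.1) :
    V ∈ goodSubspaces b d ↔
      topMinor (dehomBasis G) d ≠ 0 ∧ (wronskian (dehomBasis G)).roots.Nodup := by
  rw [goodSubspaces, Set.mem_ofPred_eq, ← rep_ne_zero_iff hbd V G]
  refine and_congr_right fun h => ?_
  have htop := (rep_ne_zero_iff hbd V G).1 h
  have hg : ∀ i, (dehomBasis G i).natDegree ≤ d := fun i => natDegree_dehom_le (G i).1.2
  have hb : badPoints V = affinePoint '' {ρ | (wronskian (dehomBasis G)).IsRoot ρ} := by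
    ext p
    constructor
    · intro hp
      have := eq_affinePoint (h p hp)
      rw [this] at hp ⊢
      exact ⟨_, (affinePoint_mem_badPoints_iff V G _).1 hp, rfl⟩
    · rintro ⟨ρ, hρ, rfl⟩
      exact (affinePoint_mem_badPoints_iff V G ρ).2 hρ
  rw [hb, affinePoint_injective.encard_image, ← natDegree_wronskian hbd hg htop,
    Polynomial.nodup_roots_iff_encard (wronskian_ne_zero hbd hg htop)]

theorem isZariskiOpen_goodSubspaces (hbd : b ≤ d) : IsZariskiOpen (goodSubspaces b d) := by
  refine ⟨{discriminant b d}, fun V G => ?_⟩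
  have hg : ∀ i, (dehomBasis G i).natDegree ≤ d := fun i => natDegree_dehom_le (G i).1.2
  rw [mem_goodSubspaces_iff hbd V G]
  simp only [Set.mem_singleton_iff, exists_eq_left]
  rw [eval_discriminant, mul_ne_zero_iff]
  refine and_congr_right fun htop => ?_
  rw [Polynomial.nodup_roots_iff_resultant (wronskian_ne_zero hbd hg htop),
    natDegree_wronskian hbd hg htop]

end BinaryForm

/-! ### Existence of a good subspace -/

namespace Polynomial

theorem exists_derivative_eq (p : Polynomial ℂ) : ∃ q : Polynomial ℂ, derivative q = p := by
  induction p using Polynomial.induction_on' with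
  | add p q hp hq =>
    obtain ⟨p', rfl⟩ := hp
    obtain ⟨q', rfl⟩ := hq
    exact ⟨p' + q', derivative_add⟩
  | monomial n a =>
    refine ⟨monomial (n + 1) (a / (n + 1)), ?_⟩
    have : (n + 1 : ℂ) ≠ 0 := Nat.cast_add_one_ne_zero n
    rw [derivative_monomial, Nat.add_sub_cancel]
    push_cast
    rw [div_mul_cancel₀ _ this]

theorem coeff_X_mul_derivative (p : Polynomial ℂ) (m : ℕ) :
    (X * derivative p).coeff m = m * p.coeff m := by
  cases m with
  | zero => simp
  | succ m =>
    rw [coeff_X_mul, coeff_derivative]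
    push_cast
    ring

theorem natDegree_X_mul_derivative_le (p : Polynomial ℂ) :
    (X * derivative p).natDegree ≤ p.natDegree := by
  rw [natDegree_le_iff_coeff_eq_zero]
  intro n hn
  rw [coeff_X_mul_derivative, coeff_eq_zero_of_natDegree_lt hn, mul_zero]

/-- After multiplication by X, the coefficient in degree deg p + deg q is (deg q − deg p) times the
product of the leading coefficients. -/
theorem mul_derivative_sub_ne_zero {p q : Polynomial ℂ} (hp : p ≠ 0)
    (h : p.natDegree < q.natDegree) : p * derivative q - derivative p * q ≠ 0 := by
  intro h0
  have h1 : p * (X * derivative q) = (X * derivative p) * q := by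
    linear_combination X * h0
  have h2 : (p * (X * derivative q)).coeff (p.natDegree + q.natDegree) =
      (X * derivative p * q).coeff (p.natDegree + q.natDegree) := by rw [h1]
  rw [coeff_mul_add_eq_of_natDegree_le le_rfl (natDegree_X_mul_derivative_le q),
    coeff_mul_add_eq_of_natDegree_le (natDegree_X_mul_derivative_le p) le_rfl,
    coeff_X_mul_derivative, coeff_X_mul_derivative] at h2
  have hq : q ≠ 0 := by
    rintro rfl
    simp at h
  have h3 : p.coeff p.natDegree * q.coeff q.natDegree ≠ 0 :=
    mul_ne_zero (leadingCoeff_ne_zero.2 hp) (leadingCoeff_ne_zero.2 hq)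
  have h4 : (q.natDegree : ℂ) = p.natDegree := mul_left_cancel₀ h3 (by linear_combination h2)
  exact h.ne' (Nat.cast_injective h4)

/-- A general member of the pencil spanned by `p` and `q` has no multiple root if `p` has none. -/
theorem exists_nodup_roots_add_C_mul {p q : Polynomial ℂ} (hp : p ≠ 0) (hr : p.roots.Nodup)
    (h : p.natDegree < q.natDegree) : ∃ c : ℂ, c ≠ 0 ∧ (p + C c * q).roots.Nodup := by
  classical
  let w := p * derivative q - derivative p * q
  have hw : w ≠ 0 := mul_derivative_sub_ne_zero hp h
  -- A multiple root z of p + cq is a zero of pq' − p'q, so there are finitely many candidates, and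
  -- each excludes one value of c. If q(z) = 0, then p(z) = 0, and simplicity of the roots of p
  -- forces q'(z) ≠ 0, whence the other formula.
  obtain ⟨c, hc⟩ := Infinite.exists_notMem_finset (insert 0 (w.roots.toFinset.image fun z =>
    if q.eval z = 0 then -(derivative p).eval z / (derivative q).eval z
      else -p.eval z / q.eval z))
  rw [Finset.mem_insert, not_or] at hc
  obtain ⟨hc0, hc⟩ := hc
  refine ⟨c, hc0, ?_⟩
  have hne : p + C c * q ≠ 0 := by
    intro h0
    rw [← natDegree_C_mul (p := q) hc0, ← natDegree_neg (C c * q), ← eq_neg_of_add_eq_zero_left h0] at h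
    exact lt_irrefl _ h
  rw [nodup_roots_iff_of_ne_zero hne]
  intro z h1 h2
  rw [nodup_roots_iff_of_ne_zero hp] at hr
  simp only [IsRoot.def, derivative_add, derivative_C_mul, eval_add, eval_mul, eval_C] at h1 h2 hr
  apply hc
  rw [Finset.mem_image]
  refine ⟨z, ?_, ?_⟩
  · rw [Multiset.mem_toFinset, mem_roots hw, IsRoot.def]
    simp only [w, eval_sub, eval_mul]
    linear_combination (derivative q).eval z * h1 - q.eval z * h2
  · split_ifs with hq
    · have h3 : p.eval z = 0 := by simpa [hq] using h1
      have h4 : (derivative q).eval z ≠ 0 := by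
        intro h5
        exact hr z h3 (by simpa [h5] using h2)
      rw [div_eq_iff h4]
      linear_combination -h2
    · rw [div_eq_iff hq]
      linear_combination -h1

end Polynomial

namespace BinaryForm

variable {b d : ℕ}

/-- With its columns reversed, the matrix is lower triangular with the coefficients of degree i + k
on the diagonal. -/
theorem topMinor_ne_zero_of_triangular {f : Fin (b + 1) → Polynomial ℂ} {k : ℕ}
    (hf : ∀ i, (f i).natDegree ≤ i + k) (hf' : ∀ i : Fin (b + 1), (f i).coeff (i + k) ≠ 0) :
    topMinor f (b + k) ≠ 0 := by
  intro h
  have h1 := Matrix.det_permute' (Fin.revPerm : Equiv.Perm (Fin (b + 1)))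
    (Matrix.of fun i k' : Fin (b + 1) => (f i).coeff (b + k - k'))
  rw [topMinor] at h
  rw [h, mul_zero, Matrix.det_of_isLowerTriangular] at h1
  · rw [Finset.prod_eq_zero_iff] at h1
    obtain ⟨i, -, hi⟩ := h1
    apply hf' i
    simp only [Matrix.submatrix_apply, Matrix.of_apply, id, Fin.revPerm_apply, Fin.val_rev] at hi
    rwa [show b + k - (b + 1 - (i + 1)) = i + k by omega] at hi
  · intro i j hij
    have hij : (i : ℕ) < j := hij
    simp only [Matrix.submatrix_apply, Matrix.of_apply, id, Fin.revPerm_apply, Fin.val_rev]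
    refine Polynomial.coeff_eq_zero_of_natDegree_lt ((hf i).trans_lt ?_)
    omega

theorem wronskian_cons (p : Polynomial ℂ) (f : Fin (b + 1) → Polynomial ℂ) :
    wronskian (Fin.cons p f : Fin (b + 1 + 1) → Polynomial ℂ) =
      ∑ j : Fin (b + 1 + 1), (-1) ^ (j : ℕ) * Polynomial.hasseDeriv j p *
        (Matrix.of fun i k : Fin (b + 1) => Polynomial.hasseDeriv (j.succAbove k) (f i)).det := by
  rw [wronskian, Matrix.det_succ_row_zero]
  rfl

theorem wronskian_cons_add_mul (p q : Polynomial ℂ) (c : ℂ) (f : Fin (b + 1) → Polynomial ℂ) :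
    wronskian (Fin.cons (p + Polynomial.C c * q) f : Fin (b + 1 + 1) → Polynomial ℂ) =
      wronskian (Fin.cons p f : Fin (b + 1 + 1) → Polynomial ℂ) +
        Polynomial.C c * wronskian (Fin.cons q f : Fin (b + 1 + 1) → Polynomial ℂ) := by
  simp only [wronskian_cons]
  rw [Finset.mul_sum, ← Finset.sum_add_distrib]
  refine Finset.sum_congr rfl fun j _ => ?_
  rw [map_add, ← Polynomial.smul_eq_C_mul, map_smul, Polynomial.smul_eq_C_mul]
  ring

/-- The constant 1 contributes the row (1, 0, …, 0), and the k-th Hasse derivative of f' is k + 1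
times the (k+1)-st of f. -/
theorem wronskian_derivative (f : Fin (b + 1) → Polynomial ℂ) :
    wronskian (fun i => Polynomial.derivative (f i)) =
      Polynomial.C (∏ k : Fin (b + 1), ((k : ℂ) + 1)) *
        wronskian (Fin.cons 1 f : Fin (b + 1 + 1) → Polynomial ℂ) := by
  rw [wronskian_cons, Fin.sum_univ_succ, Finset.sum_eq_zero, add_zero]
  · rw [wronskian, map_prod]
    simp only [Fin.val_zero, pow_zero, Polynomial.hasseDeriv_zero', one_mul]
    rw [← Matrix.det_mul_row]
    congr 1
    ext1 i k
    simp only [Matrix.of_apply, Fin.zero_succAbove, Fin.val_succ]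
    have h := LinearMap.congr_fun (Polynomial.hasseDeriv_comp (R := ℂ) k 1) (f i)
    simp only [LinearMap.comp_apply, Polynomial.hasseDeriv_one] at h
    rw [h, Nat.choose_succ_self_right]
    simp [add_mul]
  · intro j _
    rw [Fin.val_succ, Polynomial.hasseDeriv_apply_one _ (Nat.succ_pos _), mul_zero, zero_mul]

/-- Induction on b with k = d − b fixed: antiderivatives f of a good family make the Wronskian of 1,
f squarefree. As 1 has too small a degree, it is replaced by 1 + cX^k; the new Wronskian is a member
of a pencil whose other generator has larger degree, so some c ≠ 0 keeps it squarefree. -/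
theorem exists_wronskian_roots_nodup (b k : ℕ) :
    ∃ f : Fin (b + 1) → Polynomial ℂ, (∀ i, (f i).natDegree ≤ i + k) ∧
      (∀ i : Fin (b + 1), (f i).coeff (i + k) ≠ 0) ∧ (wronskian f).roots.Nodup := by
  -- For k = 0 the Wronskian has degree 0, so there are no roots; the pencil argument needs k > 0
  -- for the strict inequality of degrees.
  rcases Nat.eq_zero_or_pos k with rfl | hk
  · have h1 : ∀ i : Fin (b + 1), (Polynomial.X ^ (i : ℕ) : Polynomial ℂ).natDegree ≤ i + 0 :=
      fun i => by simp
    have h2 : ∀ i : Fin (b + 1), (Polynomial.X ^ (i : ℕ) : Polynomial ℂ).coeff (i + 0) ≠ 0 :=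
      fun i => by simp
    refine ⟨fun i => Polynomial.X ^ (i : ℕ), h1, h2, ?_⟩
    have h := natDegree_wronskian_le (d := b) le_rfl
      (g := fun i : Fin (b + 1) => (Polynomial.X ^ (i : ℕ) : Polynomial ℂ))
      fun i => (h1 i).trans (by omega)
    rw [Nat.sub_self, mul_zero] at h
    rw [Multiset.card_eq_zero.1 (Nat.le_zero.1 ((Polynomial.card_roots' _).trans h))]
    exact Multiset.nodup_zero
  induction b with
  | zero =>
    refine ⟨fun _ => Polynomial.X ^ k - Polynomial.C 1, fun i => ?_, fun i => ?_, ?_⟩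
    · rw [Polynomial.natDegree_X_pow_sub_C]
      omega
    · rw [Fin.fin_one_eq_zero i]
      simp [Polynomial.coeff_one, hk.ne']
    · rw [wronskian, Matrix.det_fin_one]
      simp only [Matrix.of_apply, Fin.val_zero, Polynomial.hasseDeriv_zero']
      exact Polynomial.nodup_roots (Polynomial.separable_X_pow_sub_C 1
        (Nat.cast_ne_zero.2 hk.ne') one_ne_zero)
  | succ b ih =>
    obtain ⟨g, hg, hg', hr⟩ := ih
    choose f hf using fun i => Polynomial.exists_derivative_eq (g i)
    have hc : ∀ i n, (f i).coeff (n + 1) * (n + 1) = (g i).coeff n := fun i n => by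
      rw [← hf, Polynomial.coeff_derivative]
    have hn : ∀ n : ℕ, (n + 1 : ℂ) ≠ 0 := Nat.cast_add_one_ne_zero
    have hdeg : ∀ i, (f i).natDegree ≤ (i : ℕ) + 1 + k := fun i => by
      rw [Polynomial.natDegree_le_iff_coeff_eq_zero]
      intro n hn'
      obtain ⟨n, rfl⟩ := Nat.exists_eq_succ_of_ne_zero (show n ≠ 0 by omega)
      have := hc i n
      rw [Polynomial.coeff_eq_zero_of_natDegree_lt ((hg i).trans_lt (by omega))] at this
      exact (mul_eq_zero.1 this).resolve_right (hn n)
    have hcoeff : ∀ i : Fin (b + 1), (f i).coeff ((i : ℕ) + 1 + k) ≠ 0 := fun i h0 => by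
      have := hc i (i + k)
      rw [show (i : ℕ) + k + 1 = i + 1 + k by omega, h0, zero_mul] at this
      exact hg' i this.symm
    have hcons : ∀ p : Polynomial ℂ, p.natDegree ≤ k → p.coeff k ≠ 0 →
        (∀ i, ((Fin.cons p f : Fin (b + 1 + 1) → Polynomial ℂ) i).natDegree ≤ i + k) ∧
        ∀ i : Fin (b + 1 + 1),
          ((Fin.cons p f : Fin (b + 1 + 1) → Polynomial ℂ) i).coeff (i + k) ≠ 0 := by
      intro p h1 h2
      constructor
      · refine Fin.cases ?_ fun i => ?_
        · simpa using h1
        · simpa using hdeg i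
      · refine Fin.cases ?_ fun i => ?_
        · simpa using h2
        · simpa using hcoeff i
    have hdegree : ∀ (b : ℕ) (f : Fin (b + 1) → Polynomial ℂ), (∀ i, (f i).natDegree ≤ i + k) →
        (∀ i : Fin (b + 1), (f i).coeff (i + k) ≠ 0) → wronskian f ≠ 0 ∧
        (wronskian f).natDegree = (b + 1) * k := by
      intro b f h1 h2
      have h3 := topMinor_ne_zero_of_triangular h1 h2
      have h4 : ∀ i, (f i).natDegree ≤ b + k := fun i => (h1 i).trans (by omega)
      refine ⟨wronskian_ne_zero (by omega) h4 h3, ?_⟩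
      rw [natDegree_wronskian (by omega) h4 h3, Nat.add_sub_cancel_left]
    obtain ⟨hw0, hw1⟩ := hdegree b g hg hg'
    have hX := hcons (Polynomial.X ^ k) (by simp) (by simp)
    obtain ⟨-, hq⟩ := hdegree _ _ hX.1 hX.2
    have hD := wronskian_derivative f
    simp only [hf] at hD
    have hprod : (∏ k : Fin (b + 1), ((k : ℂ) + 1)) ≠ 0 :=
      Finset.prod_ne_zero_iff.2 fun k _ => hn k
    rw [hD] at hr hw0 hw1
    rw [Polynomial.roots_C_mul _ hprod] at hr
    rw [Polynomial.natDegree_C_mul hprod] at hw1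
    obtain ⟨c, hc0, hcr⟩ := Polynomial.exists_nodup_roots_add_C_mul (right_ne_zero_of_mul hw0) hr
      (show _ < (wronskian (Fin.cons (Polynomial.X ^ k) f : Fin (b + 1 + 1) → _)).natDegree by
        rw [hw1, hq]
        exact Nat.mul_lt_mul_of_pos_right (Nat.lt_succ_self _) hk)
    rw [← wronskian_cons_add_mul] at hcr
    have h1 : (1 + Polynomial.C c * Polynomial.X ^ k : Polynomial ℂ).natDegree ≤ k := by
      compute_degree
    have h2 : (1 + Polynomial.C c * Polynomial.X ^ k : Polynomial ℂ).coeff k ≠ 0 := by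
      simpa [Polynomial.coeff_one, hk.ne'] using hc0
    exact ⟨_, (hcons _ h1 h2).1, (hcons _ h1 h2).2, hcr⟩

theorem exists_dehom_eq {f : Polynomial ℂ} (hf : f.natDegree ≤ d) :
    ∃ F : Forms d, dehom ℂ F.1 = f := by
  have hF : (∑ j ∈ Finset.range (d + 1), monomial (mono d j) (f.coeff j) :
      MvPolynomial (Fin 2) ℂ).IsHomogeneous d := by
    refine IsHomogeneous.sum _ _ _ fun j hj => isHomogeneous_monomial _ ?_
    have : j ≤ d := Nat.lt_succ_iff.1 (Finset.mem_range.1 hj)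
    simp [mono, Finsupp.degree_eq_sum]
    omega
  refine ⟨⟨_, hF⟩, ?_⟩
  conv_rhs => rw [f.as_sum_range' (d + 1) (Nat.lt_succ_iff.2 hf)]
  rw [dehom_eq_sum hF]
  refine Finset.sum_congr rfl fun j hj => ?_
  congr 1
  rw [coeff_sum, Finset.sum_eq_single j]
  · simp
  · intro m _ hm
    rw [coeff_monomial, if_neg fun h => hm (mono_injective d h)]
  · exact fun h => absurd hj h

theorem linearIndependent_of_topMinor_ne_zero {g : Fin (b + 1) → Polynomial ℂ}
    (h : topMinor g d ≠ 0) : LinearIndependent ℂ g := by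
  let Λ : Polynomial ℂ →ₗ[ℂ] (Fin (b + 1) → ℂ) := LinearMap.pi fun k => Polynomial.lcoeff ℂ (d - k)
  exact LinearIndependent.of_comp Λ (Matrix.linearIndependent_rows_of_det_ne_zero h)

theorem goodSubspaces_nonempty (hbd : b ≤ d) : (goodSubspaces b d).Nonempty := by
  obtain ⟨k, rfl⟩ := Nat.exists_eq_add_of_le hbd
  obtain ⟨f, hf, hf', hr⟩ := exists_wronskian_roots_nodup b k
  have htop := topMinor_ne_zero_of_triangular hf hf'
  have hfd : ∀ i, (f i).natDegree ≤ b + k := fun i => (hf i).trans (by omega)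
  choose F hF using fun i => exists_dehom_eq (hfd i)
  have hli : LinearIndependent ℂ F := by
    refine LinearIndependent.of_comp
      ((dehom ℂ).toLinearMap ∘ₗ (homogeneousSubmodule (Fin 2) ℂ (b + k)).subtype) ?_
    have h : LinearIndependent ℂ fun i => dehom ℂ (F i).1 := by
      rw [funext hF]
      exact linearIndependent_of_topMinor_ne_zero htop
    exact h
  let V : Gr b (b + k) := ⟨Submodule.span ℂ (Set.range F), by
    rw [finrank_span_eq_card hli, Fintype.card_fin]⟩
  let G : Module.Basis (Fin (b + 1)) ℂ V.1 := Module.Basis.span hli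
  have hG : dehomBasis G = f := by
    funext i
    rw [← hF i, dehomBasis]
    congr 2
    exact congrArg Subtype.val (Module.Basis.span_apply hli i)
  refine ⟨V, (mem_goodSubspaces_iff hbd V G).2 ?_⟩
  rw [hG]
  exact ⟨htop, hr⟩

end BinaryForm

/-! ### The complement of the lines and the main theorem -/

namespace BinaryForm

variable {b d : ℕ}

/-- The complement of the lines attached to the points of `badPoints V`. -/
def goodOpen {b d : ℕ} (V : Gr b d) (h : (badPoints V).Finite) : P3.Opens where
  carrier := (⋃ p ∈ badPoints V, closedLine p)ᶜ
  is_open' := (h.isClosed_biUnion fun _ _ => isClosed_closure).isOpen_compl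

theorem U_le_goodOpen (V : Gr b d) (h : (badPoints V).Finite) : U ≤ goodOpen V h := by
  intro (x : ProjectiveSpectrum grading) hx hx'
  obtain ⟨p, -, hp⟩ := Set.mem_iUnion₂.1 hx'
  exact hx (det_mem_of_mem_closedLine hp)

theorem isUnit_algebraMap_localRing {x : ProjectiveSpectrum grading} {f : R}
    (hf : f ∉ x.asHomogeneousIdeal.toIdeal) : IsUnit (algebraMap R (LocalRing x) f) :=
  IsLocalization.map_units (M := x.asHomogeneousIdeal.toIdeal.primeCompl) _ ⟨f, hf⟩

theorem det_ne_zero : (X (0, 0) * X (1, 1) - X (0, 1) * X (1, 0) : R) ≠ 0 := fun h => by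
  have := congrArg (eval fun ij : Fin 2 × Fin 2 => if ij.1 = ij.2 then (1 : ℂ) else 0) h
  simp at this

theorem isLocallyFree_sheafM_goodOpen (hbd : b ≤ d) {V : Gr b d} (hV : V ∈ goodSubspaces b d)
    (h : (badPoints V).Finite) (G : Module.Basis (Fin (b + 1)) ℂ V.1) :
    SheafOfModules.IsLocallyFree (R := (goodOpen V h).toScheme.ringCatSheaf)
      ((sheafM fun i => (G i).1).restrict (goodOpen V h).ι) := by
  refine isLocallyFree_sheafM _ _ fun x hx => ?_
  have htop := ((mem_goodSubspaces_iff hbd V G).1 hV).1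
  have hg : ∀ i, (dehomBasis G i).natDegree ≤ d := fun i => natDegree_dehom_le (G i).1.2
  have hinj : Function.Injective (algebraMap R (LocalRing x)) :=
    IsLocalization.injective _
      x.asHomogeneousIdeal.toIdeal.primeCompl_le_nonZeroDivisors
  refine hasColumnBasis hg hbd htop (wronskian_ne_zero hbd hg htop) ?_ ?_ fun ρ hρ => ?_
  · rw [← map_mul, ← map_mul, ← map_sub]
    exact (map_ne_zero_iff _ hinj).2 det_ne_zero
  · obtain ⟨i, k, hik⟩ := exists_X_notMem x
    exact ⟨i, k, isUnit_algebraMap_localRing hik⟩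
  · have hp := (affinePoint_mem_badPoints_iff V G ρ).2 hρ
    have hx' : (show P3 from x) ∉ closedLine (affinePoint ρ) := fun h' =>
      hx (Set.mem_iUnion₂.2 ⟨_, hp, h'⟩)
    rw [mem_closedLine_iff, not_forall] at hx'
    obtain ⟨k, hk⟩ := hx'
    obtain ⟨h0, h1⟩ := affinePoint_rep ρ
    -- The equation of the line of (1 : ρ) is a nonzero constant times this form, so a point off the
    -- line provides the unit required by `hasColumnBasis`.
    have h2 : (X (1, k) - C ρ * X (0, k) : R) ∉ x.asHomogeneousIdeal.toIdeal := fun h' => by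
      apply hk
      have := Ideal.mul_mem_left _ (-C ((affinePoint ρ).rep 0)) h'
      rw [lineForm, h1, C_mul]
      convert this using 1
      ring
    have h3 := isUnit_algebraMap_localRing h2
    rw [map_sub, map_mul, ← algebraMap_eq, ← IsScalarTower.algebraMap_apply] at h3
    fin_cases k
    exacts [Or.inl h3, Or.inr h3]

end BinaryForm

end

open BinaryForm in
theorem mainTheorem7 (b d : ℕ) (hbd : b ≤ d) :
    ∃ Ω : Set (Gr b d), IsZariskiOpen Ω ∧ Ω.Nonempty ∧ ∀ V ∈ Ω,
      ∃ U' : P3.Opens, U ≤ U' ∧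
        (∀ G : Module.Basis (Fin (b + 1)) ℂ V.1,
          SheafOfModules.IsLocallyFree (R := U'.toScheme.ringCatSheaf)
            ((sheafM fun i => (G i).1).restrict U'.ι)) ∧
        (badPoints V).encard = ((b + 1) * (d - b) : ℕ) ∧
        (∀ p ∈ badPoints V, IsLine (line p)) ∧
        (badPoints V).PairwiseDisjoint closedLine ∧
        (U' : Set P3)ᶜ = ⋃ p ∈ badPoints V, closedLine p := by
  refine ⟨goodSubspaces b d, isZariskiOpen_goodSubspaces hbd, goodSubspaces_nonempty hbd,
    fun V hV => ?_⟩
  have h : (badPoints V).Finite := Set.finite_of_encard_eq_coe hV.2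
  exact ⟨goodOpen V h, U_le_goodOpen V h, isLocallyFree_sheafM_goodOpen hbd hV h, hV.2,
    fun p _ => isLine_line p, fun p _ q _ hpq => disjoint_closedLine hpq, compl_compl _⟩
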